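/- Let $\alpha\in\mathbb C$, $\theta\in\mathbb R$, $\eta=\cos^2\theta$ and $\langle n_{th}\rangle\ge 0$. On (qubit $A$) $\otimes$ (qumode $B$) let $|\psi\rangle=\frac1{\sqrt2}(|0\rangle|\alpha\rangle+|1\rangle|-\alpha\rangle)$, where $|\alpha\rangle=e^{-|\alpha|^2/2}\sum_n\frac{\alpha^n}{\sqrt{n!}}|n\rangle$ is a coherent state, and let $$\rho'=\mathrm{tr}_E\bigl[U\,(|\psi\rangle\langle\psi|\otimes\rho_{th})\,U^\dagger\bigr],\qquad U=e^{\theta(a_E^\dagger a_B-a_B^\dagger a_E)},\qquad \rho_{th}=\sum_{n\ge0}\frac{\langle n_{th}\rangle^n}{(1+\langle n_{th}\rangle)^{n+1}}|n\rangle\langle n|$$ be the output of the thermal loss channel of transmissivity $\eta$ and mean thermal photon number $\langle n_{th}\rangle$ acting on the qumode. Let $a$ be the annihilation operator of the qumode, $b=|0\rangle\langle1|$ on the qubit, $\langle O\rangle=\mathrm{tr}(\rho' O)$, and let $$s_1=\begin{vmatrix}1&\langle b^\dagger\rangle&\langle ab^\dagger\rangle\\ \langle b\rangle&\langle b^\dagger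 b\rangle&\langle ab^\dagger b\rangle\\ \langle a^\dagger b\rangle&\langle a^\dagger b^\dagger b\rangle&\langle a^\dagger a\,b^\dagger b\rangle\end{vmatrix}$$ be the Shchukin–Vogel determinant. Call a state separable if it is a finite or countable convex combination of product states, entangled if it is not separable, NPT if its partial transpose is not positive semidefinite, and truly hybrid entangled if it is entangled and is not a convex combination of finitely many pure state projectors. Then: 1. $\rho'$ is a density operator, the traces defining the nine moments converge absolutely, and $$s_1=\frac{1-\eta}{4}\langle n_{th}\rangle\Bigl(1-\frac{e^{-4|\alpha|^2}}2\Bigr)-\frac{\eta|\alpha|^2}{2}e^{-4|\alpha|^2}.$$ 2. If $s_1<0$, then $\rho'$ is NPT and entangled. 3. If $\eta<1$, then $s_1<0$ if and only if $$\langle n_{th}\rangle<\frac{4\eta|\alpha|^2}{(1-\eta)(2e^{4|\alpha|^2}-1)}.\qquad(*)$$ 4. If $\eta<1$ and $\langle n_{th}\rangle>0$, then $\rho'$ is not a convex combination of finitely many pure state projectors. 5. Consequently, if $\eta<1$ and $(*)$ holds, then $\rho'$ is NPT and entangled, and it is truly hybrid entangled if moreover $\langle n_{th}\rangle>0$. 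-/

import Mathlib

/-!
Operators on Fock spaces are written as infinite matrices in the Fock (number) basis.
The qubit has basis `Fin 2`, a qumode has basis `ℕ`, and a composite system has the
product of the index types as its basis, in the order A (qubit), B (qumode), E (environment).
-/

namespace HybridEntanglement

open Matrix
open scoped Kronecker ComplexOrder

noncomputable section

/-- Product of two (possibly infinite) matrices. -/
def opMul {κ μ ν : Type*} (X : Matrix κ μ ℂ) (Y : Matrix μ ν ℂ) : Matrix κ ν ℂ :=
  fun x z => ∑' y, X x y * Y y z

/-- A density matrix: positive semidefinite with trace one. `Matrix.PosSemidef` tests the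
quadratic form on finitely supported vectors, so it also applies to infinite matrices. -/
def IsDensityMatrix {κ : Type*} (ρ : Matrix κ κ ℂ) : Prop :=
  ρ.PosSemidef ∧ HasSum (fun x => ρ x x) 1

/-- The projector `|ψ⟩⟨ψ|`. -/
def pureState {κ : Type*} (ψ : κ → ℂ) : Matrix κ κ ℂ :=
  Matrix.vecMulVec ψ (star ψ)

/-- A bipartite state is separable if it is a finite or countable convex combination of product
states (finite ones have `p i = 0` for all but finitely many `i`). -/
def IsSeparable {κ μ : Type*} (ρ : Matrix (κ × μ) (κ × μ) ℂ) : Prop :=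
  ∃ (p : ℕ → ℝ) (σ : ℕ → Matrix κ κ ℂ) (τ : ℕ → Matrix μ μ ℂ),
    (∀ i, 0 ≤ p i) ∧ HasSum p 1 ∧
    (∀ i, IsDensityMatrix (σ i)) ∧ (∀ i, IsDensityMatrix (τ i)) ∧
    ∀ x y, HasSum (fun i => (p i : ℂ) * (σ i ⊗ₖ τ i) x y) (ρ x y)

/-- A bipartite state is entangled if it is not separable. -/
def IsEntangled {κ μ : Type*} (ρ : Matrix (κ × μ) (κ × μ) ℂ) : Prop :=
  IsDensityMatrix ρ ∧ ¬ IsSeparable ρ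

/-- Partial transposition with respect to the second subsystem, in the Fock basis. -/
def partialTranspose {κ μ : Type*} (ρ : Matrix (κ × μ) (κ × μ) ℂ) :
    Matrix (κ × μ) (κ × μ) ℂ :=
  fun x y => ρ (x.1, y.2) (y.1, x.2)

/-- The partial transpose is not positive semidefinite. -/
def IsNPT {κ μ : Type*} (ρ : Matrix (κ × μ) (κ × μ) ℂ) : Prop :=
  ¬ (partialTranspose ρ).PosSemidef

/-- `ρ` is a convex combination of finitely many pure state projectors. -/
def IsFiniteMixture {κ : Type*} (ρ : Matrix κ κ ℂ) : Prop :=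
  ∃ (N : ℕ) (p : Fin N → ℝ) (ψ : Fin N → κ → ℂ),
    (∀ n, 0 < p n) ∧ ∑ n, p n = 1 ∧ (∀ n, HasSum (fun x => ‖ψ n x‖ ^ 2) 1) ∧
    ρ = ∑ n, (p n : ℂ) • pureState (ψ n)

/-- True hybrid entanglement of a qubit with a qumode: the state is entangled, and no pure state
decomposition of it has finitely many terms. -/
def IsTrulyHybridEntangled (ρ : Matrix (Fin 2 × ℕ) (Fin 2 × ℕ) ℂ) : Prop :=
  IsEntangled ρ ∧ ¬ IsFiniteMixture ρ

/-- Annihilation operator of a qumode, `a|n⟩ = √n |n-1⟩`; its adjoint is `annihilᴴ`. -/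
def annihil : Matrix ℕ ℕ ℂ :=
  fun m n => if m + 1 = n then ((Real.sqrt n : ℝ) : ℂ) else 0

/-- The qubit mode operator `b = |0⟩⟨1|`. -/
def qubitLower : Matrix (Fin 2) (Fin 2) ℂ := !![0, 1; 0, 0]

/-- The coherent state `|α⟩ = e^{-|α|²/2} ∑ αⁿ/√(n!) |n⟩`. -/
def coherent (α : ℂ) : ℕ → ℂ :=
  fun n => ((Real.exp (-‖α‖ ^ 2 / 2) : ℝ) : ℂ) * α ^ n / ((Real.sqrt (n.factorial : ℝ) : ℝ) : ℂ)

/-- The state vector `(|0⟩|α⟩ + |1⟩|-α⟩)/√2`. -/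
def hybridVector (α : ℂ) : Fin 2 × ℕ → ℂ :=
  fun x => coherent (![α, -α] x.1) x.2 / ((Real.sqrt 2 : ℝ) : ℂ)

/-- The thermal state with mean photon number `nth`. -/
def thermalState (nth : ℝ) : Matrix ℕ ℕ ℂ :=
  Matrix.diagonal fun n => ((nth ^ n / (1 + nth) ^ (n + 1) : ℝ) : ℂ)

/-- The beam splitter generator `a_E† a_B - a_B† a_E` on the modes `B`, `E` (in this order). -/
def bsGenerator : Matrix (ℕ × ℕ) (ℕ × ℕ) ℂ :=
  annihil ⊗ₖ annihilᴴ - annihilᴴ ⊗ₖ annihil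

/-- The generator conserves the total photon number, hence is a direct sum of finite blocks. -/
theorem bsGenerator_eq_zero (p q : ℕ × ℕ) (h : p.1 + p.2 ≠ q.1 + q.2) :
    bsGenerator p q = 0 := by
  obtain ⟨a, b⟩ := p
  obtain ⟨c, d⟩ := q
  simp only [bsGenerator, Matrix.sub_apply, Matrix.kroneckerMap_apply,
    Matrix.conjTranspose_apply, annihil] at h ⊢
  split_ifs <;> first | omega | simp

/-- The block of the generator with `N` photons in total. -/
def bsBlock (N : ℕ) :
    Matrix (Finset.HasAntidiagonal.antidiagonal N)
      (Finset.HasAntidiagonal.antidiagonal N) ℂ :=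
  bsGenerator.submatrix Subtype.val Subtype.val

/-- The beam splitter unitary `exp (θ (a_E† a_B - a_B† a_E))`: the exponential is taken in each
of the finite blocks of fixed total photon number. -/
def beamSplitter (θ : ℝ) : Matrix (ℕ × ℕ) (ℕ × ℕ) ℂ :=
  fun p q =>
    if h : p.1 + p.2 = q.1 + q.2 then
      NormedSpace.exp ((θ : ℂ) • bsBlock (q.1 + q.2))
        ⟨p, Finset.HasAntidiagonal.mem_antidiagonal.2 h⟩ ⟨q, Finset.HasAntidiagonal.mem_antidiagonal.2 rfl⟩
    else 0

/-- Partial trace over the second subsystem. -/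
def partialTrace {κ μ : Type*} (X : Matrix (κ × μ) (κ × μ) ℂ) : Matrix κ κ ℂ :=
  fun x y => ∑' m, X (x, m) (y, m)

/-- The unitary `1_A ⊗ U^{BE}`, on the basis of `(A ⊗ B) ⊗ E`. -/
def extendedBeamSplitter (θ : ℝ) :
    Matrix ((Fin 2 × ℕ) × ℕ) ((Fin 2 × ℕ) × ℕ) ℂ :=
  ((1 : Matrix (Fin 2) (Fin 2) ℂ) ⊗ₖ beamSplitter θ).submatrix
    (Equiv.prodAssoc (Fin 2) ℕ ℕ) (Equiv.prodAssoc (Fin 2) ℕ ℕ)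

/-- Thermal loss channel on the qumode `B`:
`ρ ↦ tr_E [U^{BE} (ρ ⊗ ρ_thermal) U^{BE}†]`, with transmissivity `cos² θ`. -/
def thermalChannel (θ nth : ℝ) (ρ : Matrix (Fin 2 × ℕ) (Fin 2 × ℕ) ℂ) :
    Matrix (Fin 2 × ℕ) (Fin 2 × ℕ) ℂ :=
  partialTrace
    (opMul (opMul (extendedBeamSplitter θ) (ρ ⊗ₖ thermalState nth)) (extendedBeamSplitter θ)ᴴ)

/-- The output of the channel on the qumode of `(|0⟩|α⟩ + |1⟩|-α⟩)/√2`. -/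
def noisyState (α : ℂ) (θ nth : ℝ) : Matrix (Fin 2 × ℕ) (Fin 2 × ℕ) ℂ :=
  thermalChannel θ nth (pureState (hybridVector α))

/-- The trace defining the moment `⟨O⟩ = tr (ρ O)` converges absolutely. -/
def HasMoment {κ : Type*} (ρ O : Matrix κ κ ℂ) : Prop :=
  Summable fun x => opMul ρ O x x

/-- The moment `⟨O⟩ = tr (ρ O)`. -/
def moment {κ : Type*} (ρ O : Matrix κ κ ℂ) : ℂ := ∑' x, opMul ρ O x x

/-- The operators whose moments are the entries of the Shchukin-Vogel determinant `s₁`: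
with `a` the qumode operator and `b` the qubit operator, the rows are
`1, b†, a b†`, then `b, b† b, a b† b`, then `a† b, a† b† b, a† a b† b`. -/
def svOperators : Matrix (Fin 3) (Fin 3) (Matrix (Fin 2 × ℕ) (Fin 2 × ℕ) ℂ) :=
  let a := annihil
  let b := qubitLower
  !![1, bᴴ ⊗ₖ 1, bᴴ ⊗ₖ a;
     b ⊗ₖ 1, (bᴴ * b) ⊗ₖ 1, (bᴴ * b) ⊗ₖ a;
     b ⊗ₖ aᴴ, (bᴴ * b) ⊗ₖ aᴴ, (bᴴ * b) ⊗ₖ opMul aᴴ a]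

/-- The Shchukin-Vogel determinant `s₁`. -/
def svDet (ρ : Matrix (Fin 2 × ℕ) (Fin 2 × ℕ) ℂ) : ℂ :=
  (Matrix.of fun i j => moment ρ (svOperators i j)).det

end

end HybridEntanglement

namespace HybridEntanglement

open Matrix
open scoped Kronecker ComplexOrder

noncomputable section

/-! ### Exponentials and intertwiners -/

/-! The beam splitter conserves photon number, so everything about it reduces to finite shells.
There the commutators `[G, a_B] = a_E` and `[G, a_E] = -a_B` exponentiate to `a_B U = U (cos θ a_B -
sin θ a_E)` (`lowerFst_mul_bsUnitary`).

Splitting each thermal weight into two square roots writes `ρ'` as a Gram matrix of square-summable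
amplitudes indexed by the final environment photon number and a purifying copy
(`noisyState_hasSum`). Moments become inner products. Both branches are eigenvectors of
annihilation, with eigenvalues `±α`, so the ladder relation evaluates these inner products from the
overlaps of the branches and the mean of the thermal distribution; the determinant is then a 3 by 3
computation.

For entanglement, the moment matrix is a convergent sum of congruences of 3 by 3 submatrices of the
partial transpose plus nonnegative diagonal matrices (`svMoments_posSemidef`). A positive partial
transpose thus forces `s₁ ≥ 0`, and Peres' criterion turns NPT into entanglement.

A finite mixture has finite rank. When `sin θ ≠ 0` and `nth > 0`, the amplitudes with empty final
environment and `k` thermal photons form a triangular array with nonzero diagonal, so the vectors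
generating the Gram matrix are linearly independent and `ρ'` has infinite rank
(`noisyState_not_isFiniteMixture`). -/

/-- The relation passes to powers and then to the exponential series term by term. `Z` is
rectangular because ladder maps join shells of different sizes. -/
theorem exp_mul_of_intertwine {m n : Type*} [Fintype m] [DecidableEq m] [Fintype n]
    [DecidableEq n] {X : Matrix m m ℂ} {Y : Matrix n n ℂ} {Z : Matrix m n ℂ}
    (h : X * Z = Z * Y) : NormedSpace.exp X * Z = Z * NormedSpace.exp Y := by
  have hpow : ∀ k : ℕ, X ^ k * Z = Z * Y ^ k := by
    intro k
    induction k with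
    | zero => simp
    | succ k ih => rw [pow_succ, Matrix.mul_assoc, h, ← Matrix.mul_assoc, ih, Matrix.mul_assoc,
        ← pow_succ]
  have hX : HasSum (fun k : ℕ => ((k.factorial : ℂ)⁻¹) • X ^ k) (NormedSpace.exp X) := by
    let _ : SeminormedRing (Matrix m m ℂ) := Matrix.linftyOpSemiNormedRing
    let _ : NormedRing (Matrix m m ℂ) := Matrix.linftyOpNormedRing
    let _ : NormedAlgebra ℂ (Matrix m m ℂ) := Matrix.linftyOpNormedAlgebra
    exact NormedSpace.exp_series_hasSum_exp' X
  have hY : HasSum (fun k : ℕ => ((k.factorial : ℂ)⁻¹) • Y ^ k) (NormedSpace.exp Y) := by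
    let _ : SeminormedRing (Matrix n n ℂ) := Matrix.linftyOpSemiNormedRing
    let _ : NormedRing (Matrix n n ℂ) := Matrix.linftyOpNormedRing
    let _ : NormedAlgebra ℂ (Matrix n n ℂ) := Matrix.linftyOpNormedAlgebra
    exact NormedSpace.exp_series_hasSum_exp' Y
  have h1 := hX.map (AddMonoidHom.mk' (fun M : Matrix m m ℂ => M * Z)
    (fun a b => Matrix.add_mul a b Z)) (continuous_id.matrix_mul continuous_const)
  have h2 := hY.map (AddMonoidHom.mk' (fun M : Matrix n n ℂ => Z * M)
    (fun a b => Matrix.mul_add Z a b)) (continuous_const.matrix_mul continuous_id)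
  have hf : (fun k : ℕ => ((k.factorial : ℂ)⁻¹ • X ^ k) * Z) =
      fun k : ℕ => Z * ((k.factorial : ℂ)⁻¹ • Y ^ k) := by
    funext k
    simp [hpow k]
  exact HasSum.unique (f := fun k : ℕ => ((k.factorial : ℂ)⁻¹ • X ^ k) * Z) h1 (hf ▸ h2)

/-- Multiplying the exponent by a scalar shift multiplies the exponential. -/
theorem exp_add_smul_one {n : Type*} [Fintype n] [DecidableEq n] (Y : Matrix n n ℂ) (c : ℂ) :
    NormedSpace.exp (Y + c • (1 : Matrix n n ℂ)) = Complex.exp c • NormedSpace.exp Y := by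
  have hc : Commute Y (c • (1 : Matrix n n ℂ)) := (Commute.one_right Y).smul_right c
  rw [Matrix.exp_add_of_commute _ _ hc]
  have : c • (1 : Matrix n n ℂ) = diagonal fun _ => c := by
    rw [← Matrix.diagonal_one, ← Matrix.diagonal_smul]; congr 1; ext; simp
  have h2 : NormedSpace.exp (fun _ : n => c) = fun _ : n => Complex.exp c := by
    rw [Pi.exp_def]; funext i; simp [Complex.exp_eq_exp_ℂ]
  rw [this, Matrix.exp_diagonal, h2, ← Matrix.smul_one_eq_diagonal]
  simp

/-! ### The blocks of the beam splitter -/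

/-- Photon pairs with `N` photons in total. -/
abbrev Shell (N : ℕ) : Type := Finset.HasAntidiagonal.antidiagonal (A := ℕ) N

theorem Shell.sum_eq {N : ℕ} (x : Shell N) : x.1.1 + x.1.2 = N :=
  Finset.HasAntidiagonal.mem_antidiagonal.1 x.2

/-- Annihilation of a photon of the first mode, as a map between shells. -/
def lowerFst (N : ℕ) : Matrix (Shell N) (Shell (N + 1)) ℂ :=
  (annihil ⊗ₖ (1 : Matrix ℕ ℕ ℂ)).submatrix Subtype.val Subtype.val

/-- Annihilation of a photon of the second mode, as a map between shells. -/
def lowerSnd (N : ℕ) : Matrix (Shell N) (Shell (N + 1)) ℂ :=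
  ((1 : Matrix ℕ ℕ ℂ) ⊗ₖ annihil).submatrix Subtype.val Subtype.val

/-- The real square root of a natural number, as a complex number. -/
abbrev csqrt (n : ℕ) : ℂ := ((Real.sqrt n : ℝ) : ℂ)

theorem csqrt_mul_self (n : ℕ) : csqrt n * csqrt n = n := by
  rw [← Complex.ofReal_mul, Real.mul_self_sqrt (Nat.cast_nonneg n)]; simp

theorem csqrt_zero : csqrt 0 = 0 := by simp [csqrt]

theorem star_csqrt (n : ℕ) : star (csqrt n) = csqrt n := Complex.conj_ofReal _

theorem csqrt_ne_zero {n : ℕ} (h : n ≠ 0) : csqrt n ≠ 0 := by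
  simp [csqrt, h]

theorem sum_shell (N : ℕ) (f : ℕ × ℕ → ℂ) :
    ∑ z : Shell N, f z.1 = ∑ z ∈ Finset.HasAntidiagonal.antidiagonal N, f z :=
  Finset.sum_coe_sort _ f

/-- Testing rows against functions on all photon pairs keeps shell membership proofs out of the
later computations. -/
theorem lowerFst_row (N : ℕ) (f : ℕ × ℕ → ℂ) (x : Shell N) :
    ∑ z, lowerFst N x z * f z.1 = csqrt (x.1.1 + 1) * f (x.1.1 + 1, x.1.2) := by
  obtain ⟨⟨a, b⟩, hx⟩ := x
  rw [Finset.HasAntidiagonal.mem_antidiagonal] at hx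
  refine (sum_shell (N + 1) fun z => (annihil ⊗ₖ (1 : Matrix ℕ ℕ ℂ)) (a, b) z * f z).trans ?_
  rw [Finset.sum_eq_single (a + 1, b)]
  · simp [annihil]
  · rintro ⟨c, d⟩ - hne
    simp only [kroneckerMap_apply, annihil, Matrix.one_apply]
    split_ifs <;> simp_all
  · intro h
    exact absurd (Finset.HasAntidiagonal.mem_antidiagonal.2 (by simp at hx ⊢; omega)) h

theorem lowerSnd_row (N : ℕ) (f : ℕ × ℕ → ℂ) (x : Shell N) :
    ∑ z, lowerSnd N x z * f z.1 = csqrt (x.1.2 + 1) * f (x.1.1, x.1.2 + 1) := by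
  obtain ⟨⟨a, b⟩, hx⟩ := x
  rw [Finset.HasAntidiagonal.mem_antidiagonal] at hx
  refine (sum_shell (N + 1) fun z => ((1 : Matrix ℕ ℕ ℂ) ⊗ₖ annihil) (a, b) z * f z).trans ?_
  rw [Finset.sum_eq_single (a, b + 1)]
  · simp [annihil]
  · rintro ⟨c, d⟩ - hne
    simp only [kroneckerMap_apply, annihil, Matrix.one_apply]
    split_ifs <;> simp_all
  · intro h
    exact absurd (Finset.HasAntidiagonal.mem_antidiagonal.2 (by simp at hx ⊢; omega)) h

/-- The truncated subtractions are harmless: where one truncates, the accompanying square root is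
zero. -/
theorem bsBlock_row (N : ℕ) (f : ℕ × ℕ → ℂ) (x : Shell N) :
    ∑ z, bsBlock N x z * f z.1 =
      csqrt (x.1.1 + 1) * csqrt x.1.2 * f (x.1.1 + 1, x.1.2 - 1)
        - csqrt x.1.1 * csqrt (x.1.2 + 1) * f (x.1.1 - 1, x.1.2 + 1) := by
  obtain ⟨⟨a, b⟩, hx⟩ := x
  rw [Finset.HasAntidiagonal.mem_antidiagonal] at hx
  refine (sum_shell N fun z => bsGenerator (a, b) z * f z).trans ?_
  simp only [bsGenerator, Matrix.sub_apply, sub_mul, Finset.sum_sub_distrib]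
  congr 1
  · rcases b with _ | b
    · simp only [csqrt_zero, mul_zero, zero_mul]
      refine Finset.sum_eq_zero ?_
      rintro ⟨c, d⟩ -
      simp [annihil]
    · rw [Finset.sum_eq_single (a + 1, b)]
      · simp [annihil, csqrt]
      · rintro ⟨c, d⟩ - hne
        simp only [kroneckerMap_apply, annihil, Matrix.conjTranspose_apply]
        split_ifs <;> simp_all
      · intro h
        exact absurd (Finset.HasAntidiagonal.mem_antidiagonal.2 (by simp at hx ⊢; omega)) h
  · rcases a with _ | a
    · simp only [csqrt_zero, zero_mul]
      refine Finset.sum_eq_zero ?_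
      rintro ⟨c, d⟩ -
      simp [annihil]
    · rw [Finset.sum_eq_single (a, b + 1)]
      · simp [annihil, csqrt]
      · rintro ⟨c, d⟩ - hne
        simp only [kroneckerMap_apply, annihil, Matrix.conjTranspose_apply]
        split_ifs <;> simp_all
      · intro h
        exact absurd (Finset.HasAntidiagonal.mem_antidiagonal.2 (by simp at hx ⊢; omega)) h

theorem shell_matrix_ext {M N : ℕ} {X Y : Matrix (Shell M) (Shell N) ℂ}
    (h : ∀ (f : ℕ × ℕ → ℂ) (x), ∑ z, X x z * f z.1 = ∑ z, Y x z * f z.1) : X = Y := by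
  ext x y
  have := h (Pi.single y.1 1) x
  simpa [Pi.single_apply, Subtype.val_inj] using this

theorem sum_mul_mul {l m n : Type*} [Fintype m] [Fintype n] (X : Matrix l m ℂ)
    (Y : Matrix m n ℂ) (x : l) (f : n → ℂ) :
    ∑ z, (X * Y) x z * f z = ∑ w, X x w * ∑ z, Y w z * f z := by
  simp only [Matrix.mul_apply, Finset.sum_mul, Finset.mul_sum, mul_assoc]
  exact Finset.sum_comm

/-- This is `[G, a_B] = a_E`, a consequence of `[a, a†] = 1`; on matrix elements it comes down to
`(a + 2) - (a + 1) = 1`, with an empty first mode treated apart. -/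
theorem bsBlock_commutator_fst (N : ℕ) :
    bsBlock N * lowerFst N = lowerFst N * bsBlock (N + 1) + lowerSnd N := by
  refine shell_matrix_ext fun f x => ?_
  simp only [Matrix.add_apply, add_mul, Finset.sum_add_distrib]
  rw [sum_mul_mul, sum_mul_mul]
  simp only [lowerFst_row, bsBlock_row, lowerSnd_row]
  rw [bsBlock_row N (fun w => csqrt (w.1 + 1) * f (w.1 + 1, w.2)),
    lowerFst_row N (fun w => csqrt (w.1 + 1) * csqrt w.2 * f (w.1 + 1, w.2 - 1)
        - csqrt w.1 * csqrt (w.2 + 1) * f (w.1 - 1, w.2 + 1))]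
  obtain ⟨⟨a, b⟩, hx⟩ := x
  have h1 := csqrt_mul_self (a + 1)
  rcases a with _ | a
  · simp only [csqrt_zero, Nat.add_sub_cancel] at *
    push_cast at *
    linear_combination csqrt (b + 1) * f (0, b + 1) * h1
  · have h2 := csqrt_mul_self (a + 1)
    simp only [Nat.add_sub_cancel] at *
    push_cast at *
    linear_combination csqrt (b + 1) * f (a + 1, b + 1) * (h1 - h2)

theorem bsBlock_commutator_snd (N : ℕ) :
    bsBlock N * lowerSnd N = lowerSnd N * bsBlock (N + 1) - lowerFst N := by
  refine shell_matrix_ext fun f x => ?_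
  simp only [Matrix.sub_apply, sub_mul, Finset.sum_sub_distrib]
  rw [sum_mul_mul, sum_mul_mul]
  simp only [lowerFst_row, bsBlock_row, lowerSnd_row]
  rw [bsBlock_row N (fun w => csqrt (w.2 + 1) * f (w.1, w.2 + 1)),
    lowerSnd_row N (fun w => csqrt (w.1 + 1) * csqrt w.2 * f (w.1 + 1, w.2 - 1)
        - csqrt w.1 * csqrt (w.2 + 1) * f (w.1 - 1, w.2 + 1))]
  obtain ⟨⟨a, b⟩, hx⟩ := x
  have h1 := csqrt_mul_self (b + 1)
  rcases b with _ | b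
  · simp only [csqrt_zero, Nat.add_sub_cancel] at *
    push_cast at *
    linear_combination (-1) * csqrt (a + 1) * f (a + 1, 0) * h1
  · have h2 := csqrt_mul_self (b + 1)
    simp only [Nat.add_sub_cancel] at *
    push_cast at *
    linear_combination csqrt (a + 1) * f (a + 1, b + 1) * (h2 - h1)

/-- The beam splitter on the shell of `N` photons. -/
def bsUnitary (θ : ℝ) (N : ℕ) : Matrix (Shell N) (Shell N) ℂ :=
  NormedSpace.exp ((θ : ℂ) • bsBlock N)

/-- For `j² = -1` the combination `a_B + j a_E` diagonalizes the commutator with the generator, with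
eigenvalue `-j`. Moving it through the exponential therefore costs only a scalar. -/
theorem bsUnitary_intertwine (θ : ℝ) (N : ℕ) (j : ℂ) (hj : j * j = -1) :
    bsUnitary θ N * (lowerFst N + j • lowerSnd N) =
      Complex.exp (-(j * θ)) • ((lowerFst N + j • lowerSnd N) * bsUnitary θ (N + 1)) := by
  have key : ((θ : ℂ) • bsBlock N) * (lowerFst N + j • lowerSnd N) =
      (lowerFst N + j • lowerSnd N) *
        ((θ : ℂ) • bsBlock (N + 1) + (-(j * θ)) • (1 : Matrix _ _ ℂ)) := by
    simp only [Matrix.mul_add, Matrix.add_mul, Matrix.smul_mul, Matrix.mul_smul, smul_add,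
      Matrix.mul_one, bsBlock_commutator_fst, bsBlock_commutator_snd]
    ext x y
    simp only [Matrix.add_apply, Matrix.smul_apply, Matrix.sub_apply, smul_eq_mul]
    linear_combination ((θ : ℂ) * lowerSnd N x y) * hj
  rw [bsUnitary, exp_mul_of_intertwine key, exp_add_smul_one, Matrix.mul_smul, bsUnitary]

/-- The cases `j = i` and `j = -i` are combined so that `a_E` cancels on the left of `U`; Euler's
formulas then give the rotation. -/
theorem lowerFst_mul_bsUnitary (θ : ℝ) (N : ℕ) :
    lowerFst N * bsUnitary θ (N + 1) = bsUnitary θ N *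
      ((Real.cos θ : ℂ) • lowerFst N - (Real.sin θ : ℂ) • lowerSnd N) := by
  have h1 := bsUnitary_intertwine θ N Complex.I Complex.I_mul_I
  have h2 := bsUnitary_intertwine θ N (-Complex.I) (by simp)
  have e1 : Complex.exp (Complex.I * θ) * Complex.exp (-(Complex.I * θ)) = 1 := by
    rw [← Complex.exp_add]; simp
  have c1 : (Real.cos θ : ℂ) =
      (Complex.exp (Complex.I * θ) + Complex.exp (-(Complex.I * θ))) / 2 := by
    rw [Complex.ofReal_cos, Complex.cos]; ring_nf
  have s1 : (Real.sin θ : ℂ) =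
      (Complex.exp (-(Complex.I * θ)) - Complex.exp (Complex.I * θ)) * Complex.I / 2 := by
    rw [Complex.ofReal_sin, Complex.sin]; ring_nf
  rw [c1, s1]
  ext x y
  have h1 := congrFun (congrFun h1 x) y
  have h2 := congrFun (congrFun h2 x) y
  simp only [neg_mul, neg_neg] at h2
  simp only [Matrix.mul_add, Matrix.add_mul, Matrix.mul_sub, Matrix.smul_mul, Matrix.mul_smul,
    Matrix.add_apply, Matrix.sub_apply, Matrix.smul_apply, smul_eq_mul] at h1 h2 ⊢
  set u := Complex.exp (Complex.I * θ)
  set w := Complex.exp (-(Complex.I * θ))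
  linear_combination (-u / 2) * h1 - (w / 2) * h2 -
    ((lowerFst N * bsUnitary θ (N + 1)) x y) * e1

theorem bsBlock_conjTranspose (N : ℕ) : (bsBlock N)ᴴ = -bsBlock N := by
  ext x y
  simp only [bsBlock, bsGenerator, Matrix.conjTranspose_apply, Matrix.submatrix_apply,
    Matrix.sub_apply, Matrix.neg_apply, kroneckerMap_apply, star_sub, star_mul', star_star]
  ring

theorem bsUnitary_conjTranspose_mul_self (θ : ℝ) (N : ℕ) :
    (bsUnitary θ N)ᴴ * bsUnitary θ N = 1 := by
  have : ((θ : ℂ) • bsBlock N)ᴴ = -((θ : ℂ) • bsBlock N) := by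
    rw [Matrix.conjTranspose_smul, bsBlock_conjTranspose]; simp
  rw [bsUnitary, ← Matrix.exp_conjTranspose, this, Matrix.exp_neg]
  exact Matrix.nonsing_inv_mul _ ((Matrix.isUnit_iff_isUnit_det _).1 (Matrix.isUnit_exp _))

/-! ### Matrix elements of the beam splitter -/

theorem beamSplitter_apply_shell (θ : ℝ) {N : ℕ} (x y : Shell N) :
    beamSplitter θ x.1 y.1 = bsUnitary θ N x y := by
  obtain ⟨x, hx⟩ := x
  obtain ⟨y, hy⟩ := y
  have hy' := hy
  rw [Finset.HasAntidiagonal.mem_antidiagonal] at hx hy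
  subst hy
  simp only [beamSplitter, dif_pos hx]
  rfl

theorem beamSplitter_apply_eq_zero (θ : ℝ) {x y : ℕ × ℕ} (h : x.1 + x.2 ≠ y.1 + y.2) :
    beamSplitter θ x y = 0 := by simp [beamSplitter, h]

theorem beamSplitter_columns_orthonormal (θ : ℝ) {N : ℕ} (p q : Shell N) :
    ∑ x ∈ Finset.HasAntidiagonal.antidiagonal N,
      beamSplitter θ x p.1 * star (beamSplitter θ x q.1) = if p = q then 1 else 0 := by
  have h := congrFun (congrFun (bsUnitary_conjTranspose_mul_self θ N) q) p
  rw [Matrix.mul_apply, Matrix.one_apply] at h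
  rw [← sum_shell N fun x => beamSplitter θ x p.1 * star (beamSplitter θ x q.1)]
  simp only [eq_comm (a := p)]
  rw [← h]
  refine Finset.sum_congr rfl fun x _ => ?_
  rw [beamSplitter_apply_shell, beamSplitter_apply_shell, Matrix.conjTranspose_apply, mul_comm]

/-- The beam splitter turns annihilation in the first mode into `cos θ a_B - sin θ a_E`. -/
theorem beamSplitter_ladder (θ : ℝ) (m e p k : ℕ) (h : m + e + 1 = p + k) :
    csqrt (m + 1) * beamSplitter θ (m + 1, e) (p, k) =
      Real.cos θ * (csqrt p * beamSplitter θ (m, e) (p - 1, k))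
        - Real.sin θ * (csqrt k * beamSplitter θ (m, e) (p, k - 1)) := by
  have hx : (m, e) ∈ Finset.HasAntidiagonal.antidiagonal (m + e) :=
    Finset.HasAntidiagonal.mem_antidiagonal.2 rfl
  have hy : (p, k) ∈ Finset.HasAntidiagonal.antidiagonal (m + e + 1) :=
    Finset.HasAntidiagonal.mem_antidiagonal.2 h.symm
  have key := congrFun (congrFun (lowerFst_mul_bsUnitary θ (m + e)) ⟨_, hx⟩) ⟨_, hy⟩
  have hL : (lowerFst (m + e) * bsUnitary θ (m + e + 1)) ⟨_, hx⟩ ⟨_, hy⟩ =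
      csqrt (m + 1) * beamSplitter θ (m + 1, e) (p, k) := by
    rw [Matrix.mul_apply, ← lowerFst_row (m + e) (fun z => beamSplitter θ z (p, k)) ⟨_, hx⟩]
    refine Finset.sum_congr rfl fun z _ => ?_
    rw [← beamSplitter_apply_shell]
  have hA : (bsUnitary θ (m + e) * lowerFst (m + e)) ⟨_, hx⟩ ⟨_, hy⟩ =
      csqrt p * beamSplitter θ (m, e) (p - 1, k) := by
    rw [Matrix.mul_apply]
    simp only [← beamSplitter_apply_shell]
    refine (sum_shell (m + e) fun z => beamSplitter θ (m, e) z *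
      (annihil ⊗ₖ (1 : Matrix ℕ ℕ ℂ)) z (p, k)).trans ?_
    rcases p with _ | p
    · rw [csqrt_zero, zero_mul]
      exact Finset.sum_eq_zero fun z _ => by simp [annihil]
    · rw [Finset.sum_eq_single (p, k)]
      · simp [annihil, mul_comm]
      · rintro ⟨c, d⟩ - hne
        simp only [kroneckerMap_apply, annihil, Matrix.one_apply]
        split_ifs <;> simp_all
      · intro h
        exact absurd (Finset.HasAntidiagonal.mem_antidiagonal.2 (by simp; omega)) h
  have hE : (bsUnitary θ (m + e) * lowerSnd (m + e)) ⟨_, hx⟩ ⟨_, hy⟩ =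
      csqrt k * beamSplitter θ (m, e) (p, k - 1) := by
    rw [Matrix.mul_apply]
    simp only [← beamSplitter_apply_shell]
    refine (sum_shell (m + e) fun z => beamSplitter θ (m, e) z *
      ((1 : Matrix ℕ ℕ ℂ) ⊗ₖ annihil) z (p, k)).trans ?_
    rcases k with _ | k
    · rw [csqrt_zero, zero_mul]
      exact Finset.sum_eq_zero fun z _ => by simp [annihil]
    · rw [Finset.sum_eq_single (p, k)]
      · simp [annihil, mul_comm]
      · rintro ⟨c, d⟩ - hne
        simp only [kroneckerMap_apply, annihil, Matrix.one_apply]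
        split_ifs <;> simp_all
      · intro h
        exact absurd (Finset.HasAntidiagonal.mem_antidiagonal.2 (by simp; omega)) h
  rw [hL] at key
  rw [key]
  simp only [Matrix.mul_sub, Matrix.mul_smul, Matrix.sub_apply, Matrix.smul_apply, smul_eq_mul,
    hA, hE]

theorem beamSplitter_vacuum (θ : ℝ) : beamSplitter θ (0, 0) (0, 0) = 1 := by
  have h0 : (0, 0) ∈ Finset.HasAntidiagonal.antidiagonal 0 :=
    Finset.HasAntidiagonal.mem_antidiagonal.2 rfl
  refine (beamSplitter_apply_shell θ (⟨_, h0⟩ : Shell 0) ⟨_, h0⟩).trans ?_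
  have : bsBlock 0 = 0 := by
    ext x y
    have hx := Shell.sum_eq x
    have hy := Shell.sum_eq y
    obtain ⟨⟨a, b⟩, _⟩ := x
    obtain ⟨⟨c, d⟩, _⟩ := y
    obtain ⟨rfl, rfl⟩ : a = 0 ∧ b = 0 := by simpa using hx
    obtain ⟨rfl, rfl⟩ : c = 0 ∧ d = 0 := by simpa using hy
    simp [bsBlock, bsGenerator, annihil]
  rw [bsUnitary, this, smul_zero, NormedSpace.exp_zero, Matrix.one_apply_eq]

/-- With no photon entering in the first mode, only the `sin θ` term of the ladder relation
survives. These entries provide the nonzero diagonal in the rank argument. -/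
theorem beamSplitter_swap (θ : ℝ) (k : ℕ) :
    beamSplitter θ (k, 0) (0, k) = (-(Real.sin θ : ℂ)) ^ k := by
  induction k with
  | zero => simpa using beamSplitter_vacuum θ
  | succ k ih =>
    have h := beamSplitter_ladder θ k 0 0 (k + 1) (by omega)
    rw [csqrt_zero, Nat.add_sub_cancel, ih] at h
    have hk : csqrt (k + 1) ≠ 0 := csqrt_ne_zero (Nat.succ_ne_zero k)
    apply mul_left_cancel₀ hk
    rw [h]
    ring

/-! ### Square-summable families -/

theorem _root_.HasSum.of_eq {ι : Type*} {f f' : ι → ℂ} {a a' : ℂ} (h : HasSum f a)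
    (hf : ∀ x, f' x = f x) (ha : a' = a) : HasSum f' a' := by
  rw [ha, show f' = f from funext hf]; exact h

theorem summable_mul_star {ι : Type*} {F G : ι → ℂ} (hF : Summable fun x => ‖F x‖ ^ 2)
    (hG : Summable fun x => ‖G x‖ ^ 2) : Summable fun x => F x * star (G x) := by
  refine Summable.of_norm_bounded (hF.add hG) fun x => ?_
  rw [norm_mul, norm_star]
  nlinarith [sq_nonneg (‖F x‖ - ‖G x‖), sq_nonneg ‖F x‖, sq_nonneg ‖G x‖]

theorem mul_star_self (z : ℂ) : z * star z = ((‖z‖ ^ 2 : ℝ) : ℂ) := by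
  rw [Complex.star_def, Complex.mul_conj']; push_cast; rfl

theorem summable_norm_sq_of_hasSum {ι : Type*} {F : ι → ℂ} {c : ℂ}
    (h : HasSum (fun x => F x * star (F x)) c) : Summable fun x => ‖F x‖ ^ 2 := by
  have := h.summable
  simp only [mul_star_self] at this
  exact Complex.summable_ofReal.1 this

/-! ### Action of the beam splitter on a state and a Fock state of the environment -/

/-- The amplitude at `x` of `U (ψ ⊗ |k⟩)`. -/
def outputAmplitude (θ : ℝ) (ψ : ℕ → ℂ) (k : ℕ) (x : ℕ × ℕ) : ℂ :=
  if k ≤ x.1 + x.2 then beamSplitter θ x (x.1 + x.2 - k, k) * ψ (x.1 + x.2 - k) else 0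

/-- On the shell of `N` photons, an environment input `k` forces the qumode input `N - k`. The sum
is thus an inner product of two columns of a unitary block. -/
theorem outputAmplitude_shell_inner (θ : ℝ) (ψ φ : ℕ → ℂ) (k l N : ℕ) :
    ∑ x ∈ Finset.HasAntidiagonal.antidiagonal N,
      outputAmplitude θ ψ k x * star (outputAmplitude θ φ l x) =
    if k = l ∧ k ≤ N then ψ (N - k) * star (φ (N - k)) else 0 := by
  by_cases hk : k ≤ N
  swap
  · rw [if_neg (fun h : k = l ∧ k ≤ N => hk h.2)]
    refine Finset.sum_eq_zero fun x hx => ?_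
    rw [Finset.HasAntidiagonal.mem_antidiagonal] at hx
    simp [outputAmplitude, hx, hk]
  by_cases hl : l ≤ N
  swap
  · rw [if_neg (fun h : k = l ∧ k ≤ N => hl (h.1 ▸ h.2))]
    refine Finset.sum_eq_zero fun x hx => ?_
    rw [Finset.HasAntidiagonal.mem_antidiagonal] at hx
    simp [outputAmplitude, hx, hl]
  have h := beamSplitter_columns_orthonormal θ
    (⟨(N - k, k), Finset.HasAntidiagonal.mem_antidiagonal.2 (by simp; omega)⟩ : Shell N)
    ⟨(N - l, l), Finset.HasAntidiagonal.mem_antidiagonal.2 (by simp; omega)⟩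
  have hrw : ∀ x ∈ Finset.HasAntidiagonal.antidiagonal N,
      outputAmplitude θ ψ k x * star (outputAmplitude θ φ l x) =
      (beamSplitter θ x (N - k, k) * star (beamSplitter θ x (N - l, l))) *
        (ψ (N - k) * star (φ (N - l))) := by
    intro x hx
    rw [Finset.HasAntidiagonal.mem_antidiagonal] at hx
    simp only [outputAmplitude, hx, hk, hl, if_true, star_mul']
    ring
  rw [Finset.sum_congr rfl hrw, ← Finset.sum_mul, h]
  by_cases hkl : k = l
  · subst hkl; simp [hk]
  · simp [hkl]

theorem hasSum_shift {f : ℕ → ℂ} {c : ℂ} (h : HasSum f c) (k : ℕ) :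
    HasSum (fun N => if k ≤ N then f (N - k) else 0) c := by
  have hi : Function.Injective fun n : ℕ => n + k := add_left_injective k
  rw [← hi.hasSum_iff]
  · simpa [Function.comp_def] using h
  · intro N hN
    rw [if_neg]
    intro hk
    exact hN ⟨N - k, by simp; omega⟩

theorem outputAmplitude_summable (θ : ℝ) {ψ : ℕ → ℂ} (hψ : Summable fun n => ‖ψ n‖ ^ 2) (k : ℕ) :
    Summable fun x => ‖outputAmplitude θ ψ k x‖ ^ 2 := by
  rw [← Finset.HasAntidiagonal.sigmaAntidiagonalEquivProd.summable_iff,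
    summable_sigma_of_nonneg (fun x => by exact sq_nonneg _)]
  refine ⟨fun N => Summable.of_finite, ?_⟩
  have hs := (hasSum_shift (Complex.hasSum_ofReal.2 hψ.hasSum) k).summable
  rw [← Complex.summable_ofReal]
  refine hs.congr fun N => ?_
  have h := outputAmplitude_shell_inner θ ψ ψ k k N
  simp only [mul_star_self, true_and] at h
  rw [← h, tsum_fintype, Complex.ofReal_sum]
  exact (sum_shell N fun x => ((‖outputAmplitude θ ψ k x‖ ^ 2 : ℝ) : ℂ)).symm

/-- The isometry property of `U`: absolute summability allows regrouping by shells, where the finite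
orthogonality relation applies. -/
theorem outputAmplitude_inner (θ : ℝ) {ψ φ : ℕ → ℂ} (hψ : Summable fun n => ‖ψ n‖ ^ 2)
    (hφ : Summable fun n => ‖φ n‖ ^ 2) {g : ℂ} (hg : HasSum (fun n => ψ n * star (φ n)) g)
    (k l : ℕ) :
    HasSum (fun x => outputAmplitude θ ψ k x * star (outputAmplitude θ φ l x))
      (if k = l then g else 0) := by
  have hs := summable_mul_star (outputAmplitude_summable θ hψ k) (outputAmplitude_summable θ hφ l)
  have h1 := (Finset.HasAntidiagonal.sigmaAntidiagonalEquivProd.hasSum_iff.2 hs.hasSum).sigma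
    (fun N => hasSum_fintype _)
  have h2 : HasSum (fun N => ∑ x ∈ Finset.HasAntidiagonal.antidiagonal N,
      outputAmplitude θ ψ k x * star (outputAmplitude θ φ l x)) (if k = l then g else 0) := by
    simp only [outputAmplitude_shell_inner]
    by_cases hkl : k = l
    · simpa [hkl] using hasSum_shift hg l
    · simp [hkl]
  have h3 : (fun N => ∑ x ∈ Finset.HasAntidiagonal.antidiagonal N,
      outputAmplitude θ ψ k x * star (outputAmplitude θ φ l x)) = _ :=
    funext fun N => (sum_shell N fun x =>
      outputAmplitude θ ψ k x * star (outputAmplitude θ φ l x)).symm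
  rw [h3] at h2
  rw [← HasSum.unique h1 h2]
  exact hs.hasSum

/-- An eigenvector of annihilation with eigenvalue `a`. -/
def IsAnnihilEigen (ψ : ℕ → ℂ) (a : ℂ) : Prop := ∀ p, csqrt (p + 1) * ψ (p + 1) = a * ψ p

theorem outputAmplitude_ladder (θ : ℝ) {ψ : ℕ → ℂ} {a : ℂ} (hψ : IsAnnihilEigen ψ a)
    (k m e : ℕ) :
    csqrt (m + 1) * outputAmplitude θ ψ k (m + 1, e) =
      Real.cos θ * a * outputAmplitude θ ψ k (m, e)
        - Real.sin θ * csqrt k * outputAmplitude θ ψ (k - 1) (m, e) := by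
  unfold outputAmplitude
  by_cases h1 : k ≤ m + e
  · obtain ⟨p, hp⟩ := Nat.exists_eq_add_of_le h1
    have hb := beamSplitter_ladder θ m e (p + 1) k (by omega)
    have e1 : m + 1 + e - k = p + 1 := by omega
    have e2 : m + e - k = p := by omega
    simp only [h1, if_true, e1, e2, Nat.add_sub_cancel, show k ≤ m + 1 + e by omega,
      show k - 1 ≤ m + e by omega] at hb ⊢
    rcases k with _ | k
    · simp only [csqrt_zero, mul_zero, zero_mul, sub_zero] at hb ⊢
      linear_combination ψ (p + 1) * hb + Real.cos θ * beamSplitter θ (m, e) (p, 0) * hψ p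
    · have e3 : m + e - (k + 1 - 1) = p + 1 := by omega
      rw [e3]
      linear_combination ψ (p + 1) * hb + Real.cos θ * beamSplitter θ (m, e) (p, k + 1) * hψ p
  -- Boundary case: before annihilation all photons come from the environment, so the eigenvalue
  -- term is absent and the `sin θ` term alone balances.
  by_cases h2 : k = m + e + 1
  · subst h2
    have hb := beamSplitter_ladder θ m e 0 (m + e + 1) (by omega)
    have e1 : m + 1 + e - (m + e + 1) = 0 := by omega
    rw [csqrt_zero] at hb
    simp only [Nat.add_sub_cancel, Nat.sub_self, e1, le_refl, if_true,
      show ¬ (m + e + 1 ≤ m + e) by omega,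
      if_false, show m + e + 1 ≤ m + 1 + e by omega] at hb ⊢
    linear_combination ψ 0 * hb
  · simp [h1, show ¬ k ≤ m + 1 + e by omega, show ¬ k ≤ m + e + 1 by omega]

/-- The amplitude of `a U (ψ ⊗ |k⟩)`. -/
def loweredAmplitude (θ : ℝ) (ψ : ℕ → ℂ) (k : ℕ) (x : ℕ × ℕ) : ℂ :=
  csqrt (x.1 + 1) * outputAmplitude θ ψ k (x.1 + 1, x.2)

/-- Of the two terms of the ladder relation, the one with environment input `k - 1` is orthogonal to
the output for `k`. -/
theorem loweredAmplitude_inner_output (θ : ℝ) {ψ φ : ℕ → ℂ} (hψ : Summable fun n => ‖ψ n‖ ^ 2)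
    (hφ : Summable fun n => ‖φ n‖ ^ 2) {g a : ℂ} (hg : HasSum (fun n => ψ n * star (φ n)) g)
    (ha : IsAnnihilEigen ψ a) (k : ℕ) :
    HasSum (fun x => loweredAmplitude θ ψ k x * star (outputAmplitude θ φ k x))
      (Real.cos θ * a * g) := by
  have h1 := (outputAmplitude_inner θ hψ hφ hg k k).mul_left (Real.cos θ * a)
  have h2 := (outputAmplitude_inner θ hψ hφ hg (k - 1) k).mul_left (Real.sin θ * csqrt k)
  refine (h1.sub h2).of_eq (fun x => ?_) ?_
  · rw [loweredAmplitude, outputAmplitude_ladder θ ha]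
    ring
  -- At `k = 0` the truncated index `k - 1` equals `k`, so orthogonality fails; the factor `csqrt 0`
  -- removes the term instead.
  · rcases k with _ | k
    · simp [csqrt_zero]
    · simp

/-- Expanding both factors by the ladder relation gives four products; the mixed ones vanish by
orthogonality or through `csqrt 0`. -/
theorem loweredAmplitude_inner (θ : ℝ) {ψ φ : ℕ → ℂ} (hψ : Summable fun n => ‖ψ n‖ ^ 2)
    (hφ : Summable fun n => ‖φ n‖ ^ 2) {g a b : ℂ} (hg : HasSum (fun n => ψ n * star (φ n)) g)
    (ha : IsAnnihilEigen ψ a) (hb : IsAnnihilEigen φ b) (k : ℕ) :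
    HasSum (fun x => loweredAmplitude θ ψ k x * star (loweredAmplitude θ φ k x))
      (((Real.cos θ : ℂ) ^ 2 * (a * star b) + (Real.sin θ : ℂ) ^ 2 * k) * g) := by
  have h1 := (outputAmplitude_inner θ hψ hφ hg k k).mul_left ((Real.cos θ : ℂ) ^ 2 * (a * star b))
  have h2 := (outputAmplitude_inner θ hψ hφ hg (k - 1) k).mul_left
    (Real.sin θ * Real.cos θ * star b * csqrt k)
  have h3 := (outputAmplitude_inner θ hψ hφ hg k (k - 1)).mul_left
    (Real.sin θ * Real.cos θ * a * csqrt k)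
  have h4 := (outputAmplitude_inner θ hψ hφ hg (k - 1) (k - 1)).mul_left
    ((Real.sin θ : ℂ) ^ 2 * (csqrt k * csqrt k))
  have hs : ∀ r : ℝ, star (r : ℂ) = r := Complex.conj_ofReal
  refine (((h1.sub h2).sub h3).add h4).of_eq (fun x => ?_) ?_
  · simp only [loweredAmplitude, outputAmplitude_ladder θ ha, outputAmplitude_ladder θ hb,
      star_sub, star_mul', hs]
    ring
  · rw [csqrt_mul_self]
    rcases k with _ | k
    · simp [csqrt_zero]
    · simp; ring

/-! ### Thermal weights -/

/-- The occupation probabilities of the thermal state. -/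
def thermalWeight (nth : ℝ) (k : ℕ) : ℝ := nth ^ k / (1 + nth) ^ (k + 1)

theorem thermalWeight_nonneg {nth : ℝ} (hn : 0 ≤ nth) (k : ℕ) : 0 ≤ thermalWeight nth k := by
  unfold thermalWeight; positivity

theorem thermalWeight_pos {nth : ℝ} (hn : 0 < nth) (k : ℕ) : 0 < thermalWeight nth k := by
  unfold thermalWeight; positivity

theorem thermalWeight_eq (nth : ℝ) (k : ℕ) :
    thermalWeight nth k = (nth / (1 + nth)) ^ k * (1 + nth)⁻¹ := by
  rw [thermalWeight, div_pow, pow_succ]; field_simp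

theorem hasSum_thermalWeight {nth : ℝ} (hn : 0 ≤ nth) : HasSum (thermalWeight nth) 1 := by
  have h0 : 0 ≤ nth / (1 + nth) := by positivity
  have h1 : nth / (1 + nth) < 1 := by rw [div_lt_one (by positivity)]; linarith
  have h := (hasSum_geometric_of_lt_one h0 h1).mul_right (1 + nth)⁻¹
  simp only [← thermalWeight_eq] at h
  have e : (1 - nth / (1 + nth))⁻¹ * (1 + nth)⁻¹ = 1 := by
    have : (1 + nth) ≠ 0 := by positivity
    have h2 : 1 - nth / (1 + nth) = (1 + nth)⁻¹ := by field_simp; ring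
    rw [h2, inv_inv, mul_inv_cancel₀ this]
  rwa [e] at h

theorem hasSum_thermalWeight_mul {nth : ℝ} (hn : 0 ≤ nth) :
    HasSum (fun k : ℕ => thermalWeight nth k * k) nth := by
  have h0 : 0 ≤ nth / (1 + nth) := by positivity
  have h1 : nth / (1 + nth) < 1 := by rw [div_lt_one (by positivity)]; linarith
  have h := (hasSum_coe_mul_geometric_of_norm_lt_one (r := nth / (1 + nth))
    (by rwa [Real.norm_of_nonneg h0])).mul_right (1 + nth)⁻¹
  have e : nth / (1 + nth) / (1 - nth / (1 + nth)) ^ 2 * (1 + nth)⁻¹ = nth := by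
    have h3 : (1 + nth) ≠ 0 := by positivity
    have h2 : 1 - nth / (1 + nth) = (1 + nth)⁻¹ := by field_simp; ring
    rw [h2]; field_simp
  rw [e] at h
  refine (funext fun k => ?_ : (fun k : ℕ => thermalWeight nth k * k) = _) ▸ h
  rw [thermalWeight_eq]; ring

/-! ### Weighted families -/

theorem star_sqrt_mul_sqrt {r : ℝ} (hr : 0 ≤ r) :
    ((Real.sqrt r : ℝ) : ℂ) * star ((Real.sqrt r : ℝ) : ℂ) = r := by
  rw [Complex.star_def, Complex.conj_ofReal, ← Complex.ofReal_mul, Real.mul_self_sqrt hr]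

theorem weighted_summable {κ : Type*} {t : ℕ → ℝ} (ht : ∀ k, 0 ≤ t k) {F : ℕ → κ → ℂ}
    {f : ℕ → ℂ} (hF : ∀ k, HasSum (fun x => F k x * star (F k x)) (f k))
    (hf : Summable fun k => (t k : ℂ) * f k) :
    Summable fun y : ℕ × κ => ‖((Real.sqrt (t y.1) : ℝ) : ℂ) * F y.1 y.2‖ ^ 2 := by
  have hk : ∀ k, HasSum (fun x => ((‖((Real.sqrt (t k) : ℝ) : ℂ) * F k x‖ ^ 2 : ℝ) : ℂ))
      ((t k : ℂ) * f k) := by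
    intro k
    refine ((hF k).mul_left (t k : ℂ)).of_eq (fun x => ?_) rfl
    rw [← mul_star_self, ← star_sqrt_mul_sqrt (ht k), star_mul']
    ring
  rw [summable_prod_of_nonneg (fun _ => by exact sq_nonneg _)]
  refine ⟨fun k => Complex.summable_ofReal.1 (hk k).summable, ?_⟩
  rw [← Complex.summable_ofReal]
  refine hf.congr fun k => ?_
  rw [Complex.ofReal_tsum]
  exact (hk k).tsum_eq.symm

/-- Cauchy–Schwarz gives absolute summability over both indices, which justifies summing over `x`
first for each `k`. -/
theorem weighted_inner {κ : Type*} {t : ℕ → ℝ} (ht : ∀ k, 0 ≤ t k) {F G : ℕ → κ → ℂ}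
    {f g h : ℕ → ℂ} (hF : ∀ k, HasSum (fun x => F k x * star (F k x)) (f k))
    (hf : Summable fun k => (t k : ℂ) * f k)
    (hG : ∀ k, HasSum (fun x => G k x * star (G k x)) (g k))
    (hg : Summable fun k => (t k : ℂ) * g k)
    (hFG : ∀ k, HasSum (fun x => F k x * star (G k x)) (h k)) {H : ℂ}
    (hH : HasSum (fun k => (t k : ℂ) * h k) H) :
    HasSum (fun y : ℕ × κ => (((Real.sqrt (t y.1) : ℝ) : ℂ) * F y.1 y.2) *
      star (((Real.sqrt (t y.1) : ℝ) : ℂ) * G y.1 y.2)) H := by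
  have hs := summable_mul_star (weighted_summable ht hF hf) (weighted_summable ht hG hg)
  have h1 := hs.hasSum.prod_fiberwise (g := fun k => (t k : ℂ) * h k) fun k =>
    ((hFG k).mul_left (t k : ℂ)).of_eq (fun x => by
      rw [← star_sqrt_mul_sqrt (ht k), star_mul']
      ring) rfl
  rw [← h1.unique hH]
  exact hs.hasSum

/-! ### Purified output amplitudes -/

/-- Moving the last of three indices to the front. -/
def rotateIndex : ℕ × (ℕ × ℕ) ≃ ℕ × (ℕ × ℕ) where
  toFun y := (y.2.2, (y.1, y.2.1))
  invFun y := (y.2.1, (y.2.2, y.1))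
  left_inv _ := rfl
  right_inv _ := rfl

/-- Amplitude of the purified output: `m` photons in the output mode, the pair `z` of the photon
numbers of the environment after the beam splitter and of its purifying copy. -/
def purifiedAmplitude (θ nth : ℝ) (ψ : ℕ → ℂ) (m : ℕ) (z : ℕ × ℕ) : ℂ :=
  ((Real.sqrt (thermalWeight nth z.2) : ℝ) : ℂ) * outputAmplitude θ ψ z.2 (m, z.1)

/-- The amplitudes of the purified output after annihilation of a photon. -/
def purifiedLowered (θ nth : ℝ) (ψ : ℕ → ℂ) (m : ℕ) (z : ℕ × ℕ) : ℂ :=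
  csqrt (m + 1) * purifiedAmplitude θ nth ψ (m + 1) z

theorem purifiedLowered_eq (θ nth : ℝ) (ψ : ℕ → ℂ) (m : ℕ) (z : ℕ × ℕ) :
    purifiedLowered θ nth ψ m z =
      ((Real.sqrt (thermalWeight nth z.2) : ℝ) : ℂ) * loweredAmplitude θ ψ z.2 (m, z.1) := by
  unfold purifiedLowered purifiedAmplitude loweredAmplitude
  ring

theorem hasSum_thermal_affine {nth : ℝ} (hn : 0 ≤ nth) (u v w : ℂ) :
    HasSum (fun k : ℕ => (thermalWeight nth k : ℂ) * ((u + v * k) * w)) ((u + v * nth) * w) := by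
  have h1 := (Complex.hasSum_ofReal.2 (hasSum_thermalWeight hn)).mul_left (u * w)
  have h2 := (Complex.hasSum_ofReal.2 (hasSum_thermalWeight_mul hn)).mul_left (v * w)
  exact (h1.add h2).of_eq (fun k => by push_cast; ring) (by push_cast; ring)

theorem hasSum_thermal_const {nth : ℝ} (hn : 0 ≤ nth) (u : ℂ) :
    HasSum (fun k : ℕ => (thermalWeight nth k : ℂ) * u) u :=
  (hasSum_thermal_affine hn 1 0 u).of_eq (fun k => by ring) (by ring)

theorem hasSum_self_inner {ψ : ℕ → ℂ} (hψ : Summable fun n => ‖ψ n‖ ^ 2) :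
    HasSum (fun n => ψ n * star (ψ n)) (∑' n, ψ n * star (ψ n)) :=
  (summable_mul_star hψ hψ).hasSum

theorem purifiedAmplitude_summable (θ : ℝ) {nth : ℝ} (hn : 0 ≤ nth) {ψ : ℕ → ℂ}
    (hψ : Summable fun n => ‖ψ n‖ ^ 2) :
    Summable fun y : ℕ × (ℕ × ℕ) => ‖purifiedAmplitude θ nth ψ y.1 y.2‖ ^ 2 :=
  rotateIndex.summable_iff.2 (weighted_summable (thermalWeight_nonneg hn)
    (fun k => by
      simpa using outputAmplitude_inner θ hψ hψ (hasSum_self_inner hψ) k k)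
    (hasSum_thermal_const hn _).summable)

theorem purifiedAmplitude_inner (θ : ℝ) {nth : ℝ} (hn : 0 ≤ nth) {ψ φ : ℕ → ℂ}
    (hψ : Summable fun n => ‖ψ n‖ ^ 2) (hφ : Summable fun n => ‖φ n‖ ^ 2) {g : ℂ}
    (hg : HasSum (fun n => ψ n * star (φ n)) g) :
    HasSum (fun y : ℕ × (ℕ × ℕ) =>
      purifiedAmplitude θ nth ψ y.1 y.2 * star (purifiedAmplitude θ nth φ y.1 y.2)) g :=
  rotateIndex.hasSum_iff.2 (weighted_inner (thermalWeight_nonneg hn)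
    (fun k => by
      simpa using outputAmplitude_inner θ hψ hψ (hasSum_self_inner hψ) k k)
    (hasSum_thermal_const hn _).summable
    (fun k => by
      simpa using outputAmplitude_inner θ hφ hφ (hasSum_self_inner hφ) k k)
    (hasSum_thermal_const hn _).summable
    (fun k => by simpa using outputAmplitude_inner θ hψ hφ hg k k)
    (hasSum_thermal_const hn g))

theorem purifiedLowered_inner_amplitude (θ : ℝ) {nth : ℝ} (hn : 0 ≤ nth) {ψ φ : ℕ → ℂ}
    (hψ : Summable fun n => ‖ψ n‖ ^ 2) (hφ : Summable fun n => ‖φ n‖ ^ 2) {g a : ℂ}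
    (hg : HasSum (fun n => ψ n * star (φ n)) g) (ha : IsAnnihilEigen ψ a) :
    HasSum (fun y : ℕ × (ℕ × ℕ) =>
      purifiedLowered θ nth ψ y.1 y.2 * star (purifiedAmplitude θ nth φ y.1 y.2))
      (Real.cos θ * a * g) := by
  simp only [purifiedLowered_eq]
  exact rotateIndex.hasSum_iff.2 (weighted_inner (thermalWeight_nonneg hn)
    (fun k => loweredAmplitude_inner θ hψ hψ (hasSum_self_inner hψ) ha ha k)
    (hasSum_thermal_affine hn _ _ _).summable
    (fun k => by
      simpa using outputAmplitude_inner θ hφ hφ (hasSum_self_inner hφ) k k)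
    (hasSum_thermal_const hn _).summable
    (fun k => loweredAmplitude_inner_output θ hψ hφ hg ha k)
    (hasSum_thermal_const hn _))

/-- The inner product for fixed `k` is affine in `k`; averaging over the thermal weights replaces
`k` by its mean `nth`. -/
theorem purifiedLowered_inner (θ : ℝ) {nth : ℝ} (hn : 0 ≤ nth) {ψ φ : ℕ → ℂ}
    (hψ : Summable fun n => ‖ψ n‖ ^ 2) (hφ : Summable fun n => ‖φ n‖ ^ 2) {g a b : ℂ}
    (hg : HasSum (fun n => ψ n * star (φ n)) g) (ha : IsAnnihilEigen ψ a)
    (hb : IsAnnihilEigen φ b) :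
    HasSum (fun y : ℕ × (ℕ × ℕ) =>
      purifiedLowered θ nth ψ y.1 y.2 * star (purifiedLowered θ nth φ y.1 y.2))
      (((Real.cos θ : ℂ) ^ 2 * (a * star b) + (Real.sin θ : ℂ) ^ 2 * nth) * g) := by
  simp only [purifiedLowered_eq]
  exact rotateIndex.hasSum_iff.2 (weighted_inner (thermalWeight_nonneg hn)
    (fun k => loweredAmplitude_inner θ hψ hψ (hasSum_self_inner hψ) ha ha k)
    (hasSum_thermal_affine hn _ _ _).summable
    (fun k => loweredAmplitude_inner θ hφ hφ (hasSum_self_inner hφ) hb hb k)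
    (hasSum_thermal_affine hn _ _ _).summable
    (fun k => loweredAmplitude_inner θ hψ hφ hg ha hb k)
    (hasSum_thermal_affine hn _ _ _))

/-! ### Coherent states -/

theorem coherent_isAnnihilEigen (α : ℂ) : IsAnnihilEigen (coherent α) α := by
  intro p
  have h : Real.sqrt ((p + 1).factorial : ℝ) = Real.sqrt (p + 1 : ℕ) * Real.sqrt p.factorial := by
    rw [← Real.sqrt_mul (Nat.cast_nonneg _), Nat.factorial_succ]; push_cast; rfl
  have h1 : csqrt (p + 1) ≠ 0 := csqrt_ne_zero (Nat.succ_ne_zero p)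
  have h2 : ((Real.sqrt p.factorial : ℝ) : ℂ) ≠ 0 := csqrt_ne_zero (Nat.factorial_ne_zero p)
  rw [coherent, coherent, h, Complex.ofReal_mul, pow_succ]
  field_simp
  ring

theorem coherent_inner (α β : ℂ) :
    HasSum (fun n => coherent α n * star (coherent β n))
      (Complex.exp (α * star β - ‖α‖ ^ 2 / 2 - ‖β‖ ^ 2 / 2)) := by
  have h := (NormedSpace.expSeries_div_hasSum_exp (α * star β)).mul_left
    (((Real.exp (-‖α‖ ^ 2 / 2) : ℝ) : ℂ) * ((Real.exp (-‖β‖ ^ 2 / 2) : ℝ) : ℂ))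
  refine h.of_eq (fun n => ?_) ?_
  · have h2 := csqrt_mul_self n.factorial
    have h3 : ((Real.sqrt n.factorial : ℝ) : ℂ) ≠ 0 := csqrt_ne_zero (Nat.factorial_ne_zero n)
    have hs : ∀ r : ℝ, star (r : ℂ) = r := Complex.conj_ofReal
    rw [← h2, coherent, coherent, star_div₀, star_mul', star_pow, hs, hs, mul_pow]
    field_simp
  · rw [← Complex.exp_eq_exp_ℂ, Complex.ofReal_exp, Complex.ofReal_exp, ← Complex.exp_add,
      ← Complex.exp_add]
    congr 1
    push_cast
    ring

/-- The qumode vector that goes with the qubit state `i`. -/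
def hybridBranch (α : ℂ) (i : Fin 2) (n : ℕ) : ℂ := hybridVector α (i, n)

/-- The displacement of the branch `i`. -/
def branchDisplacement (α : ℂ) (i : Fin 2) : ℂ := ![α, -α] i

/-- The Gram matrix of the branches. -/
def branchGram (α : ℂ) (i j : Fin 2) : ℂ :=
  if i = j then 1 / 2 else ((Real.exp (-2 * ‖α‖ ^ 2) : ℝ) : ℂ) / 2

theorem hybridBranch_isAnnihilEigen (α : ℂ) (i : Fin 2) :
    IsAnnihilEigen (hybridBranch α i) (branchDisplacement α i) := by
  intro p
  have h := coherent_isAnnihilEigen (![α, -α] i) p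
  simp only [hybridBranch, hybridVector, branchDisplacement]
  rw [← mul_div_assoc, h, mul_div_assoc]

theorem hybridBranch_inner (α : ℂ) (i j : Fin 2) :
    HasSum (fun n => hybridBranch α i n * star (hybridBranch α j n)) (branchGram α i j) := by
  have h := (coherent_inner (![α, -α] i) (![α, -α] j)).mul_left (1 / 2)
  have hs : ∀ r : ℝ, star (r : ℂ) = r := Complex.conj_ofReal
  have h2 : ((Real.sqrt 2 : ℝ) : ℂ) * ((Real.sqrt 2 : ℝ) : ℂ) = 2 := by
    rw [← Complex.ofReal_mul, Real.mul_self_sqrt (by norm_num)]; simp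
  refine h.of_eq (fun n => ?_) ?_
  · simp only [hybridBranch, hybridVector]
    rw [star_div₀, hs, div_mul_div_comm, h2]
    ring
  · have hα : α * starRingEnd ℂ α = (‖α‖ : ℂ) ^ 2 := Complex.mul_conj' α
    have e : ∀ z : ℂ, z = 0 → Complex.exp z = 1 := by
      rintro z rfl; simp
    have e' : ∀ z : ℂ, z = -2 * (‖α‖ : ℂ) ^ 2 → ((Real.exp (-(2 * ‖α‖ ^ 2)) : ℝ) : ℂ) / 2 =
        1 / 2 * Complex.exp z := by
      rintro z rfl
      rw [Complex.ofReal_exp]; push_cast; ring_nf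
    fin_cases i <;> fin_cases j <;> simp only [branchGram] <;>
      simp [-one_div, -mul_eq_mul_left_iff, -Complex.ofReal_exp]
    · refine e _ ?_
      linear_combination hα
    · refine e' _ ?_
      linear_combination -hα
    · refine e' _ ?_
      linear_combination -hα
    · refine e _ ?_
      linear_combination hα

theorem hybridBranch_summable (α : ℂ) (i : Fin 2) :
    Summable fun n => ‖hybridBranch α i n‖ ^ 2 :=
  summable_norm_sq_of_hasSum (hybridBranch_inner α i i)

theorem hybridBranch_zero_ne_zero (α : ℂ) (i : Fin 2) : hybridBranch α i 0 ≠ 0 := by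
  simp [hybridBranch, hybridVector, coherent]

/-! ### The channel output as a Gram matrix -/

/-- The infinite sum has at most one nonzero term: the thermal state is diagonal and photon
conservation fixes the qumode index. -/
theorem opMul_extendedBeamSplitter (θ nth : ℝ) (Ψ : Fin 2 × ℕ → ℂ) (i : Fin 2) (m e : ℕ)
    (w : (Fin 2 × ℕ) × ℕ) :
    opMul (extendedBeamSplitter θ) (pureState Ψ ⊗ₖ thermalState nth) ((i, m), e) w =
      thermalWeight nth w.2 * outputAmplitude θ (fun n => Ψ (i, n)) w.2 (m, e) *
        star (Ψ w.1) := by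
  obtain ⟨⟨j, q⟩, l⟩ := w
  rw [opMul, tsum_eq_single ((i, m + e - l), l)]
  · by_cases hl : l ≤ m + e
    · simp [extendedBeamSplitter, pureState, thermalState, thermalWeight, outputAmplitude, hl,
        Matrix.vecMulVec_apply]
      ring
    · simp only [extendedBeamSplitter, outputAmplitude, hl, Matrix.submatrix_apply,
        kroneckerMap_apply, Equiv.prodAssoc_apply]
      rw [beamSplitter_apply_eq_zero θ (by simp; omega)]
      simp
  · rintro ⟨⟨i', p⟩, k⟩ hne
    simp only [extendedBeamSplitter, pureState, thermalState, Matrix.submatrix_apply,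
        kroneckerMap_apply, Equiv.prodAssoc_apply, Matrix.diagonal_apply, Matrix.one_apply]
    by_cases hi : i = i'
    · by_cases hk : k = l
      · rw [beamSplitter_apply_eq_zero θ]
        · simp
        · simp only
          intro hp
          refine hne ?_
          subst hi hk
          simp; omega
      · simp [hk]
    · simp [hi]

theorem opMul_output (θ nth : ℝ) (Ψ : Fin 2 × ℕ → ℂ) (i j : Fin 2) (m n e : ℕ) :
    opMul (opMul (extendedBeamSplitter θ) (pureState Ψ ⊗ₖ thermalState nth))
        (extendedBeamSplitter θ)ᴴ ((i, m), e) ((j, n), e) =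
      ∑' l, thermalWeight nth l * outputAmplitude θ (fun n => Ψ (i, n)) l (m, e) *
        star (outputAmplitude θ (fun n => Ψ (j, n)) l (n, e)) := by
  rw [opMul]
  -- The support of the sum lies on this curve of indices. For `l > n + e` the subtraction
  -- truncates, but the beam splitter entry vanishes by photon conservation.
  have hinj : Function.Injective fun l : ℕ => (((j, n + e - l), l) : (Fin 2 × ℕ) × ℕ) := by
    intro a b h
    exact congrArg Prod.snd h
  rw [← hinj.tsum_eq]
  · refine tsum_congr fun l => ?_
    rw [opMul_extendedBeamSplitter]
    by_cases hl : l ≤ n + e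
    · simp [extendedBeamSplitter, outputAmplitude, hl]
      ring_nf
    · simp only [extendedBeamSplitter, outputAmplitude, hl, Matrix.submatrix_apply,
        Matrix.conjTranspose_apply, kroneckerMap_apply, Equiv.prodAssoc_apply]
      rw [beamSplitter_apply_eq_zero θ (x := (n, e)) (by simp; omega)]
      simp
  · rintro ⟨⟨j', q⟩, l⟩ hsupp
    rw [Function.mem_support] at hsupp
    by_contra hr
    refine hsupp ?_
    simp only [extendedBeamSplitter, Matrix.submatrix_apply, Matrix.conjTranspose_apply,
        kroneckerMap_apply, Equiv.prodAssoc_apply, Matrix.one_apply]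
    by_cases hj : j = j'
    · rw [beamSplitter_apply_eq_zero θ (x := (n, e))]
      · simp
      · simp only
        intro hq
        refine hr ⟨l, ?_⟩
        subst hj
        simp; omega
    · simp [hj]

/-- The purified amplitudes of the noisy state. -/
def noisyAmplitude (α : ℂ) (θ nth : ℝ) (i : Fin 2) : ℕ → ℕ × ℕ → ℂ :=
  purifiedAmplitude θ nth (hybridBranch α i)

theorem noisyAmplitude_row_summable (α : ℂ) (θ : ℝ) {nth : ℝ} (hn : 0 ≤ nth) (i : Fin 2) (m : ℕ) :
    Summable fun z => ‖noisyAmplitude α θ nth i m z‖ ^ 2 :=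
  (purifiedAmplitude_summable θ hn (hybridBranch_summable α i)).prod_factor m

/-- The Gram representation: the nested sums from the partial trace and the matrix product merge
into one absolutely convergent sum over the environment and its purifying copy. -/
theorem noisyState_hasSum (α : ℂ) (θ : ℝ) {nth : ℝ} (hn : 0 ≤ nth) (x y : Fin 2 × ℕ) :
    HasSum (fun z => noisyAmplitude α θ nth x.1 x.2 z * star (noisyAmplitude α θ nth y.1 y.2 z))
      (noisyState α θ nth x y) := by
  have hs := summable_mul_star (noisyAmplitude_row_summable α θ hn x.1 x.2)
    (noisyAmplitude_row_summable α θ hn y.1 y.2)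
  have e : noisyState α θ nth x y = ∑' z,
      noisyAmplitude α θ nth x.1 x.2 z * star (noisyAmplitude α θ nth y.1 y.2 z) := by
    rw [hs.tsum_prod]
    refine tsum_congr fun e => ?_
    refine (opMul_output θ nth (hybridVector α) x.1 y.1 x.2 y.2 e).trans (tsum_congr fun l => ?_)
    rw [← star_sqrt_mul_sqrt (thermalWeight_nonneg hn l)]
    simp only [noisyAmplitude, purifiedAmplitude, star_mul',
      show ∀ i, (hybridBranch α i) = fun n => hybridVector α (i, n) from fun _ => rfl]
    ring
  rw [e]
  exact hs.hasSum

/-! ### Positive semidefinite infinite matrices -/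

theorem posSemidef_of_hasSum {ι κ : Type*} {M : ι → Matrix κ κ ℂ} {R : Matrix κ κ ℂ}
    (hM : ∀ i, (M i).PosSemidef) (h : ∀ x y, HasSum (fun i => M i x y) (R x y)) :
    R.PosSemidef := by
  refine ⟨?_, fun v => ?_⟩
  · ext x y
    refine HasSum.unique ((h y x).star.of_eq (fun i => ?_) rfl) (h x y)
    exact (congrFun (congrFun (hM i).isHermitian x) y).symm
  · have hs : HasSum (fun i => v.sum fun x vx => v.sum fun y vy => star vx * M i x y * vy)
        (v.sum fun x vx => v.sum fun y vy => star vx * R x y * vy) :=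
      hasSum_sum fun x _ => hasSum_sum fun y _ => ((h x y).mul_left _).mul_right _
    exact hs.nonneg fun i => (hM i).2 v

/-- The quadratic form is tested on finitely supported vectors, so each test sees only a finite
submatrix. This transfers results on finite matrices to Fock space. -/
theorem posSemidef_of_finite_submatrix {κ : Type*} {R : Matrix κ κ ℂ}
    (h : ∀ s : Finset κ, (R.submatrix (Subtype.val : s → κ) Subtype.val).PosSemidef) :
    R.PosSemidef := by
  classical
  refine ⟨?_, fun v => ?_⟩
  · ext x y
    exact congrFun (congrFun (h {x, y}).isHermitian ⟨x, by simp⟩) ⟨y, by simp⟩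
  · have hq := (h v.support).dotProduct_mulVec_nonneg fun x => v x
    simp only [dotProduct, mulVec, Matrix.submatrix_apply, Pi.star_apply] at hq
    refine hq.trans_eq ?_
    refine Eq.trans ?_ (Finset.sum_coe_sort v.support fun x =>
      v.sum fun y vy => star (v x) * R x y * vy)
    refine Finset.sum_congr rfl fun x _ => ?_
    refine Eq.trans ?_ (Finset.sum_coe_sort v.support fun y => star (v x) * R x y * v y)
    rw [Finset.mul_sum]
    exact Finset.sum_congr rfl fun y _ => (mul_assoc _ _ _).symm

theorem posSemidef_vecMulVec_star {κ : Type*} (a : κ → ℂ) :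
    (Matrix.vecMulVec a (star a)).PosSemidef :=
  posSemidef_of_finite_submatrix fun s =>
    posSemidef_vecMulVec_self_star fun x : s => a x

theorem posSemidef_kronecker {κ μ : Type*} {σ : Matrix κ κ ℂ} {τ : Matrix μ μ ℂ}
    (hσ : σ.PosSemidef) (hτ : τ.PosSemidef) : (σ ⊗ₖ τ).PosSemidef := by
  classical
  refine posSemidef_of_finite_submatrix fun s => ?_
  have hk := (hσ.submatrix (Subtype.val : s.image Prod.fst → κ)).kronecker
    (hτ.submatrix (Subtype.val : s.image Prod.snd → μ))
  exact hk.submatrix fun x : s =>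
    (⟨x.1.1, Finset.mem_image_of_mem _ x.2⟩, ⟨x.1.2, Finset.mem_image_of_mem _ x.2⟩)

/-- The Peres criterion. -/
theorem IsSeparable.partialTranspose_posSemidef {κ μ : Type*}
    {ρ : Matrix (κ × μ) (κ × μ) ℂ} (h : IsSeparable ρ) : (partialTranspose ρ).PosSemidef := by
  obtain ⟨p, σ, τ, hp, -, hσ, hτ, hρ⟩ := h
  refine posSemidef_of_hasSum (M := fun i => (p i : ℂ) • (σ i ⊗ₖ (τ i)ᵀ)) (fun i => ?_)
    fun x y => hρ (x.1, y.2) (y.1, x.2)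
  exact (posSemidef_kronecker (hσ i).1 (hτ i).1.transpose).smul
    (Complex.zero_le_real.2 (hp i))

/-! ### Moments of the noisy state -/

theorem noisyState_posSemidef (α : ℂ) (θ : ℝ) {nth : ℝ} (hn : 0 ≤ nth) :
    (noisyState α θ nth).PosSemidef :=
  posSemidef_of_hasSum
    (M := fun z => Matrix.vecMulVec (fun x : Fin 2 × ℕ => noisyAmplitude α θ nth x.1 x.2 z)
      (star fun x : Fin 2 × ℕ => noisyAmplitude α θ nth x.1 x.2 z))
    (fun _ => posSemidef_vecMulVec_star _) (noisyState_hasSum α θ hn)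

/-- Summing the global inner product of amplitudes over the environment first leaves a sum over
matrix elements of the state. The other moments are obtained in the same way. -/
theorem hasSum_noisyState_diag (α : ℂ) (θ : ℝ) {nth : ℝ} (hn : 0 ≤ nth) (i j : Fin 2) :
    HasSum (fun m => noisyState α θ nth (i, m) (j, m)) (branchGram α i j) :=
  (purifiedAmplitude_inner θ hn (hybridBranch_summable α i) (hybridBranch_summable α j)
    (hybridBranch_inner α i j)).prod_fiberwise
    fun m => noisyState_hasSum α θ hn (i, m) (j, m)

theorem hasSum_noisyState_lower (α : ℂ) (θ : ℝ) {nth : ℝ} (hn : 0 ≤ nth) (i j : Fin 2) :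
    HasSum (fun m => csqrt (m + 1) * noisyState α θ nth (i, m + 1) (j, m))
      (Real.cos θ * branchDisplacement α i * branchGram α i j) :=
  (purifiedLowered_inner_amplitude θ hn (hybridBranch_summable α i) (hybridBranch_summable α j)
    (hybridBranch_inner α i j) (hybridBranch_isAnnihilEigen α i)).prod_fiberwise
    fun m => ((noisyState_hasSum α θ hn (i, m + 1) (j, m)).mul_left (csqrt (m + 1))).of_eq
      (fun z => by rw [purifiedLowered, mul_assoc]; rfl) rfl

theorem star_branchGram (α : ℂ) (i j : Fin 2) : star (branchGram α i j) = branchGram α j i := by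
  have hs : ∀ r : ℝ, star (r : ℂ) = r := Complex.conj_ofReal
  simp only [branchGram, eq_comm (a := j)]
  split_ifs
  · simp
  · rw [star_div₀, hs]; simp

theorem hasSum_noisyState_raise (α : ℂ) (θ : ℝ) {nth : ℝ} (hn : 0 ≤ nth) (i j : Fin 2) :
    HasSum (fun m => csqrt (m + 1) * noisyState α θ nth (i, m) (j, m + 1))
      (Real.cos θ * star (branchDisplacement α j) * branchGram α i j) := by
  have hs : ∀ r : ℝ, star (r : ℂ) = r := Complex.conj_ofReal
  refine (hasSum_noisyState_lower α θ hn j i).star.of_eq (fun m => ?_) ?_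
  · rw [star_mul', star_csqrt]
    congr 1
    exact congrFun (congrFun (noisyState_posSemidef α θ hn).isHermitian.symm _) _
  · rw [star_mul', star_mul', hs, star_branchGram]

theorem hasSum_noisyState_number (α : ℂ) (θ : ℝ) {nth : ℝ} (hn : 0 ≤ nth) (i j : Fin 2) :
    HasSum (fun m : ℕ => ((m + 1 : ℕ) : ℂ) * noisyState α θ nth (i, m + 1) (j, m + 1))
      (((Real.cos θ : ℂ) ^ 2 * (branchDisplacement α i * star (branchDisplacement α j)) +
        (Real.sin θ : ℂ) ^ 2 * nth) * branchGram α i j) :=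
  (purifiedLowered_inner θ hn (hybridBranch_summable α i) (hybridBranch_summable α j)
    (hybridBranch_inner α i j) (hybridBranch_isAnnihilEigen α i)
    (hybridBranch_isAnnihilEigen α j)).prod_fiberwise
    fun m => ((noisyState_hasSum α θ hn (i, m + 1) (j, m + 1)).mul_left ((m + 1 : ℕ) : ℂ)).of_eq
      (fun z => by
        rw [← csqrt_mul_self, purifiedLowered, purifiedLowered, star_mul', star_csqrt]
        simp only [noisyAmplitude]
        ring) rfl

theorem hasSum_fin_prod {f : Fin 2 × ℕ → ℂ} {c : Fin 2 → ℂ}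
    (h : ∀ i, HasSum (fun m => f (i, m)) (c i)) : HasSum f (∑ i, c i) := by
  have hi : ∀ i : Fin 2, HasSum (fun x : Fin 2 × ℕ => if x.1 = i then f x else 0) (c i) := by
    intro i
    rw [← (Prod.mk_right_injective i).hasSum_iff]
    · simpa [Function.comp_def] using h i
    · rintro ⟨k, m⟩ hk
      rw [if_neg]
      rintro rfl
      exact hk ⟨m, rfl⟩
  refine (hasSum_sum fun i (_ : i ∈ Finset.univ) => hi i).of_eq (fun x => ?_) rfl
  simp

/-- The trace of `ρ (β ⊗ X)` when each column `m` of `X` has its only entry in row `r m`. -/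
theorem hasSum_opMul_kronecker {ρ : Matrix (Fin 2 × ℕ) (Fin 2 × ℕ) ℂ}
    (β : Matrix (Fin 2) (Fin 2) ℂ) {X : Matrix ℕ ℕ ℂ} {r : ℕ → ℕ}
    (hX : ∀ n m, n ≠ r m → X n m = 0) {T : Fin 2 → Fin 2 → ℂ}
    (hT : ∀ i j, HasSum (fun m => ρ (i, m) (j, r m) * X (r m) m) (T i j)) :
    HasSum (fun x => opMul ρ (β ⊗ₖ X) x x) (∑ i, ∑ j, β j i * T i j) := by
  refine hasSum_fin_prod fun i => ?_
  refine (hasSum_sum fun j (_ : j ∈ Finset.univ) => (hT i j).mul_left (β j i)).of_eq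
    (fun m => ?_) rfl
  rw [opMul, tsum_eq_sum (s := Finset.univ ×ˢ {r m})]
  · rw [Finset.sum_product]
    refine Finset.sum_congr rfl fun j _ => ?_
    rw [Finset.sum_singleton, kroneckerMap_apply]
    ring
  · rintro ⟨j, n⟩ hjn
    rw [kroneckerMap_apply, hX n m (fun h => hjn (by simp [h]))]
    simp

theorem hasSum_moment_one (α : ℂ) (θ : ℝ) {nth : ℝ} (hn : 0 ≤ nth)
    (β : Matrix (Fin 2) (Fin 2) ℂ) :
    HasSum (fun x => opMul (noisyState α θ nth) (β ⊗ₖ (1 : Matrix ℕ ℕ ℂ)) x x)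
      (∑ i, ∑ j, β j i * branchGram α i j) :=
  hasSum_opMul_kronecker β (r := id) (fun n m h => Matrix.one_apply_ne h) fun i j =>
    (hasSum_noisyState_diag α θ hn i j).of_eq (fun m => by simp) rfl

theorem hasSum_moment_annihil (α : ℂ) (θ : ℝ) {nth : ℝ} (hn : 0 ≤ nth)
    (β : Matrix (Fin 2) (Fin 2) ℂ) :
    HasSum (fun x => opMul (noisyState α θ nth) (β ⊗ₖ annihil) x x)
      (∑ i, ∑ j, β j i * (Real.cos θ * branchDisplacement α i * branchGram α i j)) := by
  refine hasSum_opMul_kronecker β (r := fun m => m - 1) (fun n m h => ?_) fun i j => ?_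
  · rw [annihil, if_neg (by omega)]
  -- Column `0` of `annihil` is zero, so the truncated row index at `m = 0` does not matter and the
  -- series may start at `1`.
  · rw [← hasSum_nat_add_iff' 1]
    refine (hasSum_noisyState_lower α θ hn i j).of_eq (fun m => ?_) ?_
    · simp [annihil, mul_comm, csqrt]
    · simp [annihil]

theorem hasSum_moment_creation (α : ℂ) (θ : ℝ) {nth : ℝ} (hn : 0 ≤ nth)
    (β : Matrix (Fin 2) (Fin 2) ℂ) :
    HasSum (fun x => opMul (noisyState α θ nth) (β ⊗ₖ annihilᴴ) x x)
      (∑ i, ∑ j, β j i * (Real.cos θ * star (branchDisplacement α j) * branchGram α i j)) := by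
  refine hasSum_opMul_kronecker β (r := fun m => m + 1) (fun n m h => ?_) fun i j => ?_
  · rw [Matrix.conjTranspose_apply, annihil, if_neg (by omega), star_zero]
  · refine (hasSum_noisyState_raise α θ hn i j).of_eq (fun m => ?_) rfl
    simp [annihil, mul_comm, csqrt]

theorem opMul_creation_annihil :
    opMul annihilᴴ annihil = Matrix.diagonal fun n : ℕ => (n : ℂ) := by
  ext n m
  rw [opMul]
  rcases n with _ | n
  · rw [Matrix.diagonal_apply]
    simp [annihil]
  · rw [tsum_eq_single n]
    · have h := csqrt_mul_self (n + 1)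
      by_cases hnm : n + 1 = m
      · subst hnm
        simpa [annihil, csqrt] using h
      · simp [annihil, hnm]
    · intro k hk
      simp [annihil, hk]

theorem hasSum_moment_number (α : ℂ) (θ : ℝ) {nth : ℝ} (hn : 0 ≤ nth)
    (β : Matrix (Fin 2) (Fin 2) ℂ) :
    HasSum (fun x => opMul (noisyState α θ nth) (β ⊗ₖ opMul annihilᴴ annihil) x x)
      (∑ i, ∑ j, β j i *
        (((Real.cos θ : ℂ) ^ 2 * (branchDisplacement α i * star (branchDisplacement α j)) +
          (Real.sin θ : ℂ) ^ 2 * nth) * branchGram α i j)) := by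
  rw [opMul_creation_annihil]
  refine hasSum_opMul_kronecker β (r := id) (fun n m h => Matrix.diagonal_apply_ne _ h)
    fun i j => ?_
  rw [← hasSum_nat_add_iff' 1]
  refine (hasSum_noisyState_number α θ hn i j).of_eq (fun m => ?_) ?_
  · simp [mul_comm]
  · simp

/-- The values of the moments in the Shchukin-Vogel matrix of the noisy state. -/
def svMoments (α : ℂ) (θ nth : ℝ) : Matrix (Fin 3) (Fin 3) ℂ :=
  let c : ℂ := Real.cos θ
  let g : ℂ := ((Real.exp (-2 * ‖α‖ ^ 2) : ℝ) : ℂ) / 2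
  !![1, g, c * α * g;
     g, 1 / 2, c * -α * (1 / 2);
     c * star α * g, c * star (-α) * (1 / 2),
       (c ^ 2 * (-α * star (-α)) + (Real.sin θ : ℂ) ^ 2 * nth) * (1 / 2)]

theorem qubitLower_number : qubitLowerᴴ * qubitLower = !![0, 0; 0, 1] := by
  ext i j
  fin_cases i <;> fin_cases j <;> simp [qubitLower, Matrix.mul_apply]

theorem hasSum_svMoments (α : ℂ) (θ : ℝ) {nth : ℝ} (hn : 0 ≤ nth) (i j : Fin 3) :
    HasSum (fun x => opMul (noisyState α θ nth) (svOperators i j) x x)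
      (svMoments α θ nth i j) := by
  have h1 : (1 : Matrix (Fin 2 × ℕ) (Fin 2 × ℕ) ℂ) = 1 ⊗ₖ (1 : Matrix ℕ ℕ ℂ) :=
    Matrix.one_kronecker_one.symm
  fin_cases i <;> fin_cases j
  · have h := hasSum_moment_one α θ hn 1
    rw [← h1] at h
    refine h.of_eq (fun _ => rfl) ?_
    simp [svMoments, branchGram, Matrix.one_apply]
    norm_num
  · refine (hasSum_moment_one α θ hn qubitLowerᴴ).of_eq (fun _ => rfl) ?_
    simp [svMoments, branchGram, qubitLower]
  · refine (hasSum_moment_annihil α θ hn qubitLowerᴴ).of_eq (fun _ => rfl) ?_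
    simp [svMoments, branchGram, qubitLower, branchDisplacement]
  · refine (hasSum_moment_one α θ hn qubitLower).of_eq (fun _ => rfl) ?_
    simp [svMoments, branchGram, qubitLower]
  · refine (hasSum_moment_one α θ hn (qubitLowerᴴ * qubitLower)).of_eq (fun _ => rfl) ?_
    simp [svMoments, branchGram, qubitLower_number]
  · refine (hasSum_moment_annihil α θ hn (qubitLowerᴴ * qubitLower)).of_eq (fun _ => rfl) ?_
    simp [svMoments, branchGram, qubitLower_number, branchDisplacement]
  · refine (hasSum_moment_creation α θ hn qubitLower).of_eq (fun _ => rfl) ?_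
    simp [svMoments, branchGram, qubitLower, branchDisplacement]
  · refine (hasSum_moment_creation α θ hn (qubitLowerᴴ * qubitLower)).of_eq (fun _ => rfl) ?_
    simp [svMoments, branchGram, qubitLower_number, branchDisplacement]
  · refine (hasSum_moment_number α θ hn (qubitLowerᴴ * qubitLower)).of_eq (fun _ => rfl) ?_
    simp [svMoments, branchGram, qubitLower_number, branchDisplacement]

theorem svDet_noisyState_eq_det (α : ℂ) (θ : ℝ) {nth : ℝ} (hn : 0 ≤ nth) :
    svDet (noisyState α θ nth) = (svMoments α θ nth).det := by
  rw [svDet]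
  congr 1
  ext i j
  exact (hasSum_svMoments α θ hn i j).tsum_eq

theorem svDet_noisyState (α : ℂ) (θ : ℝ) {nth : ℝ} (hn : 0 ≤ nth) :
    svDet (noisyState α θ nth) =
      (((1 - Real.cos θ ^ 2) / 4 * nth * (1 - Real.exp (-4 * ‖α‖ ^ 2) / 2)
        - Real.cos θ ^ 2 * ‖α‖ ^ 2 / 2 * Real.exp (-4 * ‖α‖ ^ 2) : ℝ) : ℂ) := by
  have hα : α * star α = (‖α‖ : ℂ) ^ 2 := Complex.mul_conj' α
  have he : Real.exp (-4 * ‖α‖ ^ 2) = Real.exp (-2 * ‖α‖ ^ 2) ^ 2 := by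
    rw [← Real.exp_nat_mul]; congr 1; push_cast; ring
  have hsin : (Real.sin θ : ℂ) ^ 2 = 1 - (Real.cos θ : ℂ) ^ 2 := by
    rw [← Complex.ofReal_pow, ← Complex.ofReal_pow, Real.sin_sq]; push_cast; rfl
  rw [svDet_noisyState_eq_det α θ hn, svMoments, Matrix.det_fin_three, he, hsin]
  generalize Real.exp (-2 * ‖α‖ ^ 2) = E
  generalize hc : Real.cos θ = c
  simp only [Matrix.of_apply, Matrix.cons_val', Matrix.cons_val_zero, Matrix.cons_val_one,
    Matrix.cons_val, Matrix.cons_val_fin_one, star_neg]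
  push_cast
  linear_combination (-(c : ℂ) ^ 2 * (E : ℂ) ^ 2 / 2) * hα

/-! ### The partial transpose and the Shchukin-Vogel matrix -/

/-- Partial transposition exchanges the qumode indices, so `⟨a b†⟩` is a series of entries of the
partial transpose between `(0, m)` and `(1, m + 1)`, with weights `√(m + 1)`. All nine moments fit
this pattern simultaneously, up to a diagonal correction. -/
theorem svMoments_posSemidef (α : ℂ) (θ : ℝ) {nth : ℝ} (hn : 0 ≤ nth)
    (h : (partialTranspose (noisyState α θ nth)).PosSemidef) :
    (svMoments α θ nth).PosSemidef := by
  let e : ℕ → Fin 3 → Fin 2 × ℕ := fun m => ![(0, m), (1, m), (1, m + 1)]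
  let d : ℕ → Fin 3 → ℂ := fun m => ![1, 1, csqrt (m + 1)]
  -- The chosen submatrix supplies only the qubit-`0` part of the trace in the corner entry `⟨1⟩`;
  -- this nonnegative term adds the qubit-`1` part.
  let f : ℕ → Fin 3 → ℂ := fun m => ![noisyState α θ nth (1, m) (1, m), 0, 0]
  have hf : ∀ m, 0 ≤ f m := by
    intro m k
    fin_cases k
    · exact (noisyState_posSemidef α θ hn).diag_nonneg
    · exact le_rfl
    · exact le_rfl
  refine posSemidef_of_hasSum
    (M := fun m => (diagonal (d m))ᴴ *
      ((partialTranspose (noisyState α θ nth)).submatrix (e m) (e m)) * diagonal (d m)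
        + diagonal (f m))
    (fun m => ((h.submatrix (e m)).conjTranspose_mul_mul_same _).add
      (PosSemidef.diagonal (hf m))) fun i j => ?_
  have hm : ∀ m, ((diagonal (d m))ᴴ *
      ((partialTranspose (noisyState α θ nth)).submatrix (e m) (e m)) * diagonal (d m)
        + diagonal (f m)) i j =
      d m i * d m j * noisyState α θ nth ((e m i).1, (e m j).2) ((e m j).1, (e m i).2)
        + diagonal (f m) i j := by
    intro m
    have hd : star (d m i) = d m i := by
      fin_cases i
      · simp [d]
      · simp [d]
      · exact star_csqrt (m + 1)
    rw [Matrix.add_apply, Matrix.mul_diagonal, Matrix.diagonal_conjTranspose,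
      Matrix.diagonal_mul, Pi.star_apply, hd]
    simp only [Matrix.submatrix_apply, partialTranspose]
    ring
  simp only [hm]
  fin_cases i <;> fin_cases j
  · refine ((hasSum_noisyState_diag α θ hn 0 0).add (hasSum_noisyState_diag α θ hn 1 1)).of_eq
      (fun m => ?_) ?_
    · simp [d, e, f]
    · simp [svMoments, branchGram]; norm_num
  · refine (hasSum_noisyState_diag α θ hn 0 1).of_eq (fun m => ?_) ?_
    · simp [d, e]
    · simp [svMoments, branchGram]
  · refine (hasSum_noisyState_lower α θ hn 0 1).of_eq (fun m => ?_) ?_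
    · simp [d, e]
    · simp [svMoments, branchGram, branchDisplacement]
  · refine (hasSum_noisyState_diag α θ hn 1 0).of_eq (fun m => ?_) ?_
    · simp [d, e]
    · simp [svMoments, branchGram]
  · refine (hasSum_noisyState_diag α θ hn 1 1).of_eq (fun m => ?_) ?_
    · simp [d, e, f]
    · simp [svMoments, branchGram]
  · refine (hasSum_noisyState_lower α θ hn 1 1).of_eq (fun m => ?_) ?_
    · simp [d, e]
    · simp [svMoments, branchGram, branchDisplacement]
  · refine (hasSum_noisyState_raise α θ hn 1 0).of_eq (fun m => ?_) ?_
    · simp [d, e]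
    · simp [svMoments, branchGram, branchDisplacement]
  · refine (hasSum_noisyState_raise α θ hn 1 1).of_eq (fun m => ?_) ?_
    · simp [d, e]
    · simp [svMoments, branchGram, branchDisplacement]
  · refine (hasSum_noisyState_number α θ hn 1 1).of_eq (fun m => ?_) ?_
    · rw [← csqrt_mul_self]
      simp [d, e, f]
    · simp [svMoments, branchGram, branchDisplacement]

theorem isNPT_of_svDet_neg (α : ℂ) (θ : ℝ) {nth : ℝ} (hn : 0 ≤ nth)
    (h : (svDet (noisyState α θ nth)).re < 0) : IsNPT (noisyState α θ nth) := by
  intro hp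
  have hd := (svMoments_posSemidef α θ hn hp).det_nonneg
  rw [← svDet_noisyState_eq_det α θ hn] at hd
  exact absurd (Complex.le_def.1 hd).1 (not_le.2 h)

theorem noisyState_isDensityMatrix (α : ℂ) (θ : ℝ) {nth : ℝ} (hn : 0 ≤ nth) :
    IsDensityMatrix (noisyState α θ nth) := by
  have h := hasSum_fin_prod (f := fun x => noisyState α θ nth x x)
    fun i => hasSum_noisyState_diag α θ hn i i
  refine ⟨noisyState_posSemidef α θ hn, h.of_eq (fun _ => rfl) ?_⟩
  simp [branchGram]

theorem IsNPT.isEntangled {κ μ : Type*} {ρ : Matrix (κ × μ) (κ × μ) ℂ} (h : IsNPT ρ)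
    (hρ : IsDensityMatrix ρ) : IsEntangled ρ :=
  ⟨hρ, fun hs => h hs.partialTranspose_posSemidef⟩

/-! ### Infinite rank -/

theorem IsFiniteMixture.exists_kernel {κ : Type*} {ρ : Matrix κ κ ℂ} (h : IsFiniteMixture ρ)
    (e : ℕ → κ) :
    ∃ (n : ℕ) (v : Fin n → ℂ), v ≠ 0 ∧
      ∀ x, ∑ m : Fin n, ρ x (e m) * v m = 0 := by
  obtain ⟨N, p, ψ, -, -, -, rfl⟩ := h
  -- `N` pure states impose `N` linear conditions on `N + 1` unknowns; a common solution is
  -- annihilated by every projector.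
  let A : Matrix (Fin N) (Fin (N + 1)) ℂ := fun n m => star (ψ n (e m))
  obtain ⟨v, hv, hv0⟩ := (Submodule.ne_bot_iff _).1
    (LinearMap.ker_ne_bot_of_finrank_lt (f := A.mulVecLin) (by simp))
  refine ⟨N + 1, v, hv0, fun x => ?_⟩
  have hA : ∀ n, ∑ m : Fin (N + 1), star (ψ n (e m)) * v m = 0 := fun n => congrFun hv n
  simp only [Matrix.sum_apply, Matrix.smul_apply, pureState, Matrix.vecMulVec_apply,
    Pi.star_apply, smul_eq_mul, Finset.sum_mul]
  rw [Finset.sum_comm]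
  refine Finset.sum_eq_zero fun n _ => ?_
  have := congrArg (fun w => (p n : ℂ) * ψ n x * w) (hA n)
  simp only [Finset.mul_sum, mul_zero] at this
  rw [← this]
  exact Finset.sum_congr rfl fun m _ => by ring

/-- With an empty final environment, an output of `m` photons cannot come from `k > m` thermal ones:
this is the triangularity behind infinite rank. -/
theorem noisyAmplitude_eq_zero_of_lt (α : ℂ) (θ nth : ℝ) (i : Fin 2) {m k : ℕ} (h : m < k) :
    noisyAmplitude α θ nth i m (0, k) = 0 := by
  simp [noisyAmplitude, purifiedAmplitude, outputAmplitude, h]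

theorem noisyAmplitude_self_ne_zero (α : ℂ) {θ nth : ℝ} (hθ : Real.sin θ ≠ 0) (hn : 0 < nth)
    (i : Fin 2) (k : ℕ) : noisyAmplitude α θ nth i k (0, k) ≠ 0 := by
  have h1 : ((Real.sqrt (thermalWeight nth k) : ℝ) : ℂ) ≠ 0 :=
    Complex.ofReal_ne_zero.2 (Real.sqrt_ne_zero'.2 (thermalWeight_pos hn k))
  have h2 : (-(Real.sin θ : ℂ)) ^ k ≠ 0 :=
    pow_ne_zero _ (neg_ne_zero.2 (Complex.ofReal_ne_zero.2 hθ))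
  have h3 := hybridBranch_zero_ne_zero α i
  have h4 : outputAmplitude θ (hybridBranch α i) k (k, 0) =
      (-(Real.sin θ : ℂ)) ^ k * hybridBranch α i 0 := by
    simp only [outputAmplitude, add_zero, le_refl, if_true, Nat.sub_self, beamSplitter_swap]
  rw [noisyAmplitude, purifiedAmplitude, h4]
  exact mul_ne_zero h1 (mul_ne_zero h2 h3)

theorem noisyState_not_isFiniteMixture (α : ℂ) {θ nth : ℝ} (hθ : Real.sin θ ≠ 0) (hn : 0 < nth) :
    ¬ IsFiniteMixture (noisyState α θ nth) := by
  intro h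
  obtain ⟨n, v, hv, hk⟩ := h.exists_kernel fun m => ((0 : Fin 2), m)
  -- By the Gram representation, the quadratic form of the state at the kernel vector `v` is the
  -- squared norm of `w`, so `w` vanishes.
  let w : ℕ × ℕ → ℂ := fun z => ∑ m : Fin n, star (v m) * noisyAmplitude α θ nth 0 m z
  have hs : HasSum (fun z => w z * star (w z)) 0 := by
    have h0 := hasSum_sum fun m (_ : m ∈ (Finset.univ : Finset (Fin n))) =>
      hasSum_sum fun l (_ : l ∈ (Finset.univ : Finset (Fin n))) =>
        ((noisyState_hasSum α θ hn.le (0, (m : ℕ)) (0, (l : ℕ))).mul_left (star (v m))).mul_right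
          (v l)
    refine h0.of_eq (fun z => ?_) ?_
    · simp only [w, star_sum, star_mul', star_star, Finset.sum_mul, Finset.mul_sum]
      rw [Finset.sum_comm]
      exact Finset.sum_congr rfl fun m _ => Finset.sum_congr rfl fun l _ => by ring
    · symm
      refine Finset.sum_eq_zero fun m _ => ?_
      have := congrArg (fun u => star (v m) * u) (hk (0, (m : ℕ)))
      simp only [Finset.mul_sum, mul_zero] at this
      rw [← this]
      exact Finset.sum_congr rfl fun l _ => by ring
  have hw : ∀ z, w z = 0 := by
    simp only [mul_star_self] at hs
    have hr : HasSum (fun z => ‖w z‖ ^ 2) 0 := by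
      rw [← Complex.hasSum_ofReal]; simpa using hs
    intro z
    have := congrFun ((hasSum_zero_iff_of_nonneg fun z => sq_nonneg ‖w z‖).1 hr) z
    simpa using this
  obtain ⟨m₀, hm₀⟩ := Function.ne_iff.1 hv
  -- At the largest index `k` with `v k ≠ 0`, triangularity removes the smaller indices from `w (0,
  -- k)` and maximality the larger ones.
  let S : Finset (Fin n) := Finset.univ.filter fun m => v m ≠ 0
  have hS : S.Nonempty := ⟨m₀, by simpa [S] using hm₀⟩
  have hmem : v (S.max' hS) ≠ 0 := by simpa [S] using S.max'_mem hS
  set k := S.max' hS with hkdef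
  have h0 : w (0, (k : ℕ)) = star (v k) * noisyAmplitude α θ nth 0 k (0, (k : ℕ)) := by
    refine Finset.sum_eq_single k (fun m _ hmk => ?_) (by simp)
    rcases lt_or_gt_of_ne hmk with hlt | hgt
    · rw [noisyAmplitude_eq_zero_of_lt α θ nth 0 (Fin.lt_def.1 hlt), mul_zero]
    · have : v m = 0 := by
        by_contra hne
        exact absurd (S.le_max' m (by simpa [S] using hne)) (not_le.2 hgt)
      rw [this, star_zero, zero_mul]
  exact mul_ne_zero (star_ne_zero.2 hmem) (noisyAmplitude_self_ne_zero α hθ hn 0 k)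
    (h0 ▸ hw (0, (k : ℕ)))

/-! ### The threshold -/

theorem svDet_neg_iff {η nth r : ℝ} (hη : η < 1) (hr : 0 ≤ r) :
    (1 - η) / 4 * nth * (1 - Real.exp (-4 * r) / 2) - η * r / 2 * Real.exp (-4 * r) < 0 ↔
      nth < 4 * η * r / ((1 - η) * (2 * Real.exp (4 * r) - 1)) := by
  have hE : 1 ≤ Real.exp (4 * r) := Real.one_le_exp (by positivity)
  have hinv : Real.exp (-4 * r) = (Real.exp (4 * r))⁻¹ := by rw [← Real.exp_neg]; congr 1; ring
  rw [hinv]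
  generalize Real.exp (4 * r) = E at hE
  have hE0 : 0 < E := by linarith
  rw [lt_div_iff₀ (mul_pos (by linarith) (by linarith))]
  -- Over the positive common denominator `8 * E`, the sign is that of the cross-multiplied
  -- threshold inequality; `E ≥ 1` makes `2 * E - 1` positive.
  have e : (1 - η) / 4 * nth * (1 - E⁻¹ / 2) - η * r / 2 * E⁻¹ =
      (nth * ((1 - η) * (2 * E - 1)) - 4 * η * r) / (8 * E) := by
    field_simp
    ring
  rw [e, div_lt_iff₀ (by positivity), zero_mul, sub_neg]


end

end HybridEntanglement

open HybridEntanglement in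
theorem mainTheorem7 (α : ℂ) (θ η nth : ℝ) (hη : η = Real.cos θ ^ 2) (hn : 0 ≤ nth) :
    HybridEntanglement.IsDensityMatrix (HybridEntanglement.noisyState α θ nth) ∧
    (∀ i j, HybridEntanglement.HasMoment (HybridEntanglement.noisyState α θ nth)
      (HybridEntanglement.svOperators i j)) ∧
    HybridEntanglement.svDet (HybridEntanglement.noisyState α θ nth) =
      (((1 - η) / 4 * nth * (1 - Real.exp (-4 * ‖α‖ ^ 2) / 2)
        - η * ‖α‖ ^ 2 / 2 * Real.exp (-4 * ‖α‖ ^ 2) : ℝ) : ℂ) ∧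
    ((HybridEntanglement.svDet (HybridEntanglement.noisyState α θ nth)).re < 0 →
      HybridEntanglement.IsNPT (HybridEntanglement.noisyState α θ nth) ∧
      HybridEntanglement.IsEntangled (HybridEntanglement.noisyState α θ nth)) ∧
    (η < 1 →
      ((HybridEntanglement.svDet (HybridEntanglement.noisyState α θ nth)).re < 0 ↔
        nth < 4 * η * ‖α‖ ^ 2 / ((1 - η) * (2 * Real.exp (4 * ‖α‖ ^ 2) - 1)))) ∧
    (η < 1 → 0 < nth →
      ¬ HybridEntanglement.IsFiniteMixture (HybridEntanglement.noisyState α θ nth)) ∧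
    (η < 1 → nth < 4 * η * ‖α‖ ^ 2 / ((1 - η) * (2 * Real.exp (4 * ‖α‖ ^ 2) - 1)) →
      HybridEntanglement.IsNPT (HybridEntanglement.noisyState α θ nth) ∧
      HybridEntanglement.IsEntangled (HybridEntanglement.noisyState α θ nth) ∧
      (0 < nth →
        HybridEntanglement.IsTrulyHybridEntangled
          (HybridEntanglement.noisyState α θ nth))) := by
  subst hη
  have hs : Real.cos θ ^ 2 < 1 → Real.sin θ ≠ 0 := by
    intro h h0
    have := Real.sin_sq_add_cos_sq θ
    rw [h0] at this
    linarith
  have hdet := svDet_noisyState α θ hn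
  have hneg : (svDet (noisyState α θ nth)).re < 0 →
      IsNPT (noisyState α θ nth) ∧ IsEntangled (noisyState α θ nth) := fun h =>
    have hp := isNPT_of_svDet_neg α θ hn h
    ⟨hp, hp.isEntangled (noisyState_isDensityMatrix α θ hn)⟩
  have hiff : Real.cos θ ^ 2 < 1 → ((svDet (noisyState α θ nth)).re < 0 ↔
      nth < 4 * Real.cos θ ^ 2 * ‖α‖ ^ 2 /
        ((1 - Real.cos θ ^ 2) * (2 * Real.exp (4 * ‖α‖ ^ 2) - 1))) := by
    intro h
    rw [hdet, Complex.ofReal_re]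
    exact svDet_neg_iff h (sq_nonneg _)
  refine ⟨noisyState_isDensityMatrix α θ hn, fun i j => (hasSum_svMoments α θ hn i j).summable,
    hdet, hneg, hiff, fun h h0 => noisyState_not_isFiniteMixture α (hs h) h0, fun h hlt => ?_⟩
  obtain ⟨hp, he⟩ := hneg ((hiff h).2 hlt)
  exact ⟨hp, he, fun h0 => ⟨he, noisyState_not_isFiniteMixture α (hs h) h0⟩⟩
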